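/- Let $\psi:(0,\infty)\to(0,\infty)$ be an arbitrary continuously differentiable function with $\psi'(x)>0$ for all $x>0$, and such that $\zeta\mapsto \log(1+\psi(\zeta^2))/\zeta^2$ is integrable on $(0,\infty)$. For $\lambda>0$ define $\psi_\lambda:(0,\infty)\to\mathbf{R}$ by $$\psi_\lambda(\xi)=\frac{1-\xi/\lambda^2}{1-\psi(\xi)/\psi(\lambda^2)}\quad(\xi\ne\lambda^2),\qquad \psi_\lambda(\lambda^2)=\frac{\psi(\lambda^2)}{\lambda^2\psi'(\lambda^2)} .$$ Then for all $\lambda,\xi>0$ the function $\psi_\lambda$ is positive and the integral in $$\psi_\lambda^\dagger(\xi)=\exp\left(\frac1\pi\int_0^\infty\frac{\xi\log\psi_\lambda(\zeta^2)}{\xi^2+\zeta^2}\,d\zeta\right)$$ converges absolutely, so that $\psi_\lambda^\dagger(\xi)$ is well defined; and for all $\xi_1,\xi_2>0$ the following integral converges absolutely and $$\int_0^\infty\frac{\lambda^4\,\psi'(\lambda^2)\,(\xi_1+\xi_2)\,\psi_\lambda^\dagger(\xi_1)\,\psi_\lambda^\dagger(\xi_2)}{\psi(\lambda^2)\,(\lambda^2+\xi_1^2)(\lambda^2+\xi_2^2)}\,d\lambda=\frac{\pi}{2}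 .$$ -/

import Mathlib

open MeasureTheory Set

noncomputable section

/-- The integrand `ξ log f(ζ²) / (ξ² + ζ²)` (as a function of `ζ`) in the exponent of `f^†(ξ)`. -/
def daggerIntegrand (f : ℝ → ℝ) (ξ ζ : ℝ) : ℝ :=
  ξ * Real.log (f (ζ ^ 2)) / (ξ ^ 2 + ζ ^ 2)

/-- The Wiener-Hopf type transform
`f^†(ξ) = exp ((1/π) ∫_0^∞ ξ log f(ζ²) / (ξ² + ζ²) dζ)`, for `f` positive on `(0, ∞)` and `ξ > 0`
such that the integral converges. -/
def dagger (f : ℝ → ℝ) (ξ : ℝ) : ℝ :=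
  Real.exp ((1 / Real.pi) * ∫ ζ in Ioi (0 : ℝ), daggerIntegrand f ξ ζ)

/-- The function `ψ_lam(ξ) = (1 - ξ / lam²) / (1 - ψ(ξ) / ψ(lam²))`, with its continuous extension
`ψ(lam²) / (lam² ψ'(lam²))` at `ξ = lam²`. -/
def psiLambda (ψ : ℝ → ℝ) (lam ξ : ℝ) : ℝ :=
  if ξ = lam ^ 2 then ψ (lam ^ 2) / (lam ^ 2 * deriv ψ (lam ^ 2))
  else (1 - ξ / lam ^ 2) / (1 - ψ ξ / ψ (lam ^ 2))

/-- The integrand, as a function of `lam`, of the integral identity. -/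
def piOverTwoIntegrand (ψ : ℝ → ℝ) (ξ₁ ξ₂ lam : ℝ) : ℝ :=
  lam ^ 4 * deriv ψ (lam ^ 2) * (ξ₁ + ξ₂) *
      dagger (psiLambda ψ lam) ξ₁ * dagger (psiLambda ψ lam) ξ₂ /
    (ψ (lam ^ 2) * (lam ^ 2 + ξ₁ ^ 2) * (lam ^ 2 + ξ₂ ^ 2))

end

/-!
The identity is Cauchy's theorem for a function holomorphic off a half-line. Let `μ` be the measure
on `(0, ∞)` with density `π⁻¹ (ξ₁ / (ξ₁² + ζ²) + ξ₂ / (ξ₂² + ζ²))`, a probability measure, and let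
`H(z) = exp (-∫ log (1 + ψ(ζ²) / z) dμ(ζ))`. This is holomorphic in `ℂ ∖ (-∞, 0]` and real on
`(0, ∞)`, it tends to `0` at the origin and to `1` at infinity. In the coordinate `z = e^w` (where
`H` is `WienerHopf.factor`), Cauchy's theorem on the rectangle `[a, b] × [0, θ]` says that the
integral of `Im H` along its upper side is the difference of the integrals of `Re H` over the arcs
`|z| = e^b` and `|z| = e^a` (`integral_im_factor`). As `θ → π`, `a → -∞` and `b → ∞`, the arcs give
`π - 0`.

The boundary value of `H` at `z = -ψ(λ²)` has modulus `exp (-∫ log |1 - ψ(ζ²) / ψ(λ²)| dμ)` and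
argument `π μ(λ, ∞) = arctan (ξ₁ / λ) + arctan (ξ₂ / λ)` (`tendsto_factor_boundary`). Since
`log |1 - ψ(ζ²) / ψ(λ²)| = log |1 - ζ² / λ²| - log ψ_λ(ζ²)`, and the Poisson integral of
`log |1 - ζ² / λ²|` is `log (1 + ξ² / λ²) / 2` (`integral_log_abs_one_sub_sq_div`), the modulus is
`∏ ψ_λ^†(ξⱼ) / √(1 + ξⱼ² / λ²)`. Hence, after the substitution `x = log ψ(λ²)`, the imaginary part
of `H` on the cut is twice the integrand in question (`Admissible.tendsto_im_factor`).

Two domination arguments justify the limits. For `λ` in a compact interval,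
`|1 + t / z| ≥ |1 - t / |z||` bounds `|H|` near the cut by its boundary modulus, which is bounded
because `ψ_λ(ζ²) ≤ C (1 + ζ²)` uniformly. On the arcs the trivial bound for `|H|` is the inverse of
the distance to the cut, which just fails to be integrable; but if `ψ(ζ²) / |z|` avoids a
neighbourhood of `1` on a set of positive mass `p`, the exponent improves to `1 - p`
(`norm_factor_le`). For bounded `ψ` the cut ends at `-M = -sup ψ`; the arc integral is continuous in
the radius up to `M` and constant beyond, so it still tends to `π`
(`tendsto_arcIntegral_of_bounded`).
-/

namespace WienerHopf

open Filter Topology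

/-! ### The holomorphic factor in the slit plane -/

/-- The function `1 + t e^{-w}`, the value of `1 + t / z` in the logarithmic coordinate
`z = e^w`. -/
noncomputable def base (t : ℝ) (w : ℂ) : ℂ := 1 + t * Complex.exp (-w)

theorem base_re (t : ℝ) (w : ℂ) :
    (base t w).re = 1 + t * Real.exp (-w.re) * Real.cos w.im := by
  simp [base, Complex.exp_re, mul_assoc]

theorem base_im (t : ℝ) (w : ℂ) :
    (base t w).im = -(t * Real.exp (-w.re) * Real.sin w.im) := by
  simp [base, Complex.exp_im, mul_assoc]

theorem norm_base_sq (t : ℝ) (w : ℂ) :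
    ‖base t w‖ ^ 2 = 1 + 2 * (t * Real.exp (-w.re)) * Real.cos w.im
      + (t * Real.exp (-w.re)) ^ 2 := by
  rw [Complex.sq_norm, Complex.normSq_apply, base_re, base_im]
  linear_combination (t * Real.exp (-w.re)) ^ 2 * Real.sin_sq_add_cos_sq w.im

theorem norm_base_le {t : ℝ} (ht : 0 ≤ t) (w : ℂ) :
    ‖base t w‖ ≤ 1 + t * Real.exp (-w.re) := by
  have h0 : 0 ≤ t * Real.exp (-w.re) := by positivity
  refine abs_le_of_sq_le_sq' ?_ (by positivity) |>.2
  rw [norm_base_sq]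
  nlinarith [Real.cos_le_one w.im]

theorem abs_one_sub_le_norm_base {t : ℝ} (ht : 0 ≤ t) (w : ℂ) :
    |1 - t * Real.exp (-w.re)| ≤ ‖base t w‖ := by
  have h0 : 0 ≤ t * Real.exp (-w.re) := by positivity
  refine abs_le_of_sq_le_sq ?_ (by positivity)
  rw [norm_base_sq]
  nlinarith [Real.neg_one_le_cos w.im]

theorem cos_half_pos {y : ℝ} (hy : |y| < Real.pi) : 0 < Real.cos (y / 2) := by
  rw [abs_lt] at hy
  exact Real.cos_pos_of_mem_Ioo ⟨by linarith, by linarith⟩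

/-- Inside the strip, `1 + t e^{-w}` stays away from `0` uniformly in `t ≥ 0`. -/
theorem cos_half_mul_le_norm_base {t : ℝ} (ht : 0 ≤ t) (w : ℂ) :
    Real.cos (w.im / 2) * (1 + t * Real.exp (-w.re)) ≤ ‖base t w‖ := by
  have h0 : 0 ≤ t * Real.exp (-w.re) := by positivity
  refine abs_le_of_sq_le_sq' ?_ (by positivity) |>.2
  have hc : Real.cos w.im = 2 * Real.cos (w.im / 2) ^ 2 - 1 := by
    rw [← Real.cos_two_mul]; ring_nf
  rw [norm_base_sq, hc]
  nlinarith [mul_nonneg (sq_nonneg (1 - t * Real.exp (-w.re)))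
    (sub_nonneg.2 (Real.cos_sq_le_one (w.im / 2)))]

theorem norm_base_pos {t : ℝ} (ht : 0 ≤ t) {w : ℂ} (hw : |w.im| < Real.pi) :
    0 < ‖base t w‖ :=
  lt_of_lt_of_le (mul_pos (cos_half_pos hw) (by positivity)) (cos_half_mul_le_norm_base ht w)

theorem base_mem_slitPlane {t : ℝ} (ht : 0 ≤ t) {w : ℂ} (hw : |w.im| < Real.pi) :
    base t w ∈ Complex.slitPlane := by
  rw [Complex.mem_slitPlane_iff]
  by_contra! h
  obtain ⟨h1, h2⟩ := h
  rw [base_im, neg_eq_zero, mul_eq_zero] at h2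
  rw [base_re] at h1
  rcases h2 with h2 | h2
  · rw [h2] at h1; norm_num at h1
  · rw [Real.sin_eq_zero_iff_of_lt_of_lt (abs_lt.1 hw).1 (abs_lt.1 hw).2] at h2
    rw [h2, Real.cos_zero] at h1
    have : 0 ≤ t * Real.exp (-w.re) := by positivity
    linarith

theorem norm_log_le (z : ℂ) : ‖Complex.log z‖ ≤ |Real.log ‖z‖| + Real.pi := by
  refine (Complex.norm_le_abs_re_add_abs_im _).trans ?_
  rw [Complex.log_re, Complex.log_im]
  gcongr
  exact Complex.abs_arg_le_pi z

/-- The growth in `t` of `log (1 + t e^{-w})`: it is that of `log (1 + t)`. -/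
theorem norm_log_base_le {t : ℝ} (ht : 0 ≤ t) {w : ℂ} (hw : |w.im| < Real.pi) :
    ‖Complex.log (base t w)‖ ≤
      Real.log (1 + t) + max 0 (-w.re) - Real.log (Real.cos (w.im / 2)) + Real.pi := by
  refine (norm_log_le _).trans ?_
  gcongr
  have hc := cos_half_pos hw
  have hlc : Real.log (Real.cos (w.im / 2)) ≤ 0 := Real.log_nonpos hc.le (Real.cos_le_one _)
  have hlt : 0 ≤ Real.log (1 + t) := Real.log_nonneg (by linarith)
  have hm : 0 ≤ max 0 (-w.re) := le_max_left _ _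
  have hpos : 0 ≤ t * Real.exp (-w.re) := by positivity
  have hup : Real.log ‖base t w‖ ≤ Real.log (1 + t) + max 0 (-w.re) := by
    calc Real.log ‖base t w‖ ≤ Real.log ((1 + t) * Real.exp (max 0 (-w.re))) := by
          refine Real.log_le_log (norm_base_pos ht hw) ((norm_base_le ht w).trans ?_)
          have h1 : Real.exp (-w.re) ≤ Real.exp (max 0 (-w.re)) :=
            Real.exp_le_exp.2 (le_max_right _ _)
          have h2 : 1 ≤ Real.exp (max 0 (-w.re)) := Real.one_le_exp hm
          nlinarith
      _ = _ := by
          rw [Real.log_mul (by positivity) (by positivity), Real.log_exp]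
  have hlo : Real.log (Real.cos (w.im / 2)) ≤ Real.log ‖base t w‖ := by
    refine Real.log_le_log hc ((?_ : _ ≤ _).trans (cos_half_mul_le_norm_base ht w))
    nlinarith
  rw [abs_le]
  constructor <;> linarith

theorem norm_deriv_log_base_le {t : ℝ} (ht : 0 ≤ t) {w : ℂ} (hw : |w.im| < Real.pi) :
    ‖(t : ℂ) * Complex.exp (-w) / base t w‖ ≤ (Real.cos (w.im / 2))⁻¹ := by
  have hc := cos_half_pos hw
  have h := cos_half_mul_le_norm_base ht w
  rw [norm_div, norm_mul, Complex.norm_exp, Complex.norm_real, Real.norm_of_nonneg ht,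
    Complex.neg_re, div_le_iff₀ (norm_base_pos ht hw), ← div_eq_inv_mul, le_div_iff₀ hc]
  nlinarith

theorem hasDerivAt_log_base {t : ℝ} (ht : 0 ≤ t) {w : ℂ} (hw : |w.im| < Real.pi) :
    HasDerivAt (fun w => Complex.log (base t w)) (-(t * Complex.exp (-w) / base t w)) w := by
  have h1 : HasDerivAt (base t) (t * (Complex.exp (-w) * -1)) w := by
    unfold base
    exact (((hasDerivAt_neg w).cexp).const_mul (t : ℂ)).const_add 1
  convert h1.clog (base_mem_slitPlane ht hw) using 1
  ring

variable {Ω : Type*} [MeasurableSpace Ω] (μ : Measure Ω) (g : Ω → ℝ)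

/-- The logarithm of `factor`, with the sign reversed: the average of `log (1 + g e^{-w})`. -/
noncomputable def logPotential (w : ℂ) : ℂ := ∫ ω, Complex.log (base (g ω) w) ∂μ

/-- The Wiener–Hopf factor `exp (-∫ log (1 + g / z) dμ)` in the logarithmic coordinate
`z = e^w`; the slit plane `z ∉ (-∞, 0]` is the strip `|Im w| < π`. -/
noncomputable def factor (w : ℂ) : ℂ := Complex.exp (-logPotential μ g w)

/-- The mean of `Re (factor μ g)` over the upper half of the circle `|z| = e^x`, times `π`. -/
noncomputable def arcIntegral (x : ℝ) : ℝ :=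
  ∫ y in (0 : ℝ)..Real.pi, (factor μ g (x + y * Complex.I)).re

variable {μ g}

theorem aestronglyMeasurable_log_base (hg : AEMeasurable g μ) (w : ℂ) :
    AEStronglyMeasurable (fun ω => Complex.log (base (g ω) w)) μ := by
  refine (Complex.measurable_log.comp_aemeasurable ?_).aestronglyMeasurable
  unfold base
  exact ((Complex.measurable_ofReal.comp_aemeasurable hg).mul_const _).const_add 1

theorem integrable_log_base [IsFiniteMeasure μ] (hg : AEMeasurable g μ) (h0 : ∀ᵐ ω ∂μ, 0 ≤ g ω)
    (hlog : Integrable (fun ω => Real.log (1 + g ω)) μ) {w : ℂ} (hw : |w.im| < Real.pi) :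
    Integrable (fun ω => Complex.log (base (g ω) w)) μ := by
  refine Integrable.mono' (g := fun ω => Real.log (1 + g ω) + max 0 (-w.re)
    - Real.log (Real.cos (w.im / 2)) + Real.pi) ?_ (aestronglyMeasurable_log_base hg w) ?_
  · exact ((hlog.add (integrable_const _)).sub (integrable_const _)).add (integrable_const _)
  · filter_upwards [h0] with ω hω
    exact norm_log_base_le hω hw

theorem differentiableAt_logPotential [IsFiniteMeasure μ] (hg : AEMeasurable g μ)
    (h0 : ∀ᵐ ω ∂μ, 0 ≤ g ω) (hlog : Integrable (fun ω => Real.log (1 + g ω)) μ) {w : ℂ}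
    (hw : |w.im| < Real.pi) :
    DifferentiableAt ℂ (logPotential μ g) w := by
  obtain ⟨θ, hθ1, hθ2⟩ := exists_between hw
  have hθ0 : 0 ≤ θ := (abs_nonneg _).trans hθ1.le
  have hs : {w : ℂ | |w.im| < θ} ∈ 𝓝 w :=
    (isOpen_lt (by fun_prop) continuous_const).mem_nhds hθ1
  refine ((hasDerivAt_integral_of_dominated_loc_of_deriv_le
    (bound := fun _ => (Real.cos (θ / 2))⁻¹)
    (F' := fun w ω => -((g ω : ℂ) * Complex.exp (-w) / base (g ω) w)) hs
    (Eventually.of_forall fun w => aestronglyMeasurable_log_base hg w)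
    (integrable_log_base hg h0 hlog hw) ?_ ?_ (integrable_const _) ?_).2).differentiableAt
  · have := Complex.measurable_ofReal.comp_aemeasurable hg
    refine AEMeasurable.aestronglyMeasurable ?_
    unfold base
    exact ((this.mul_const _).div ((this.mul_const _).const_add 1)).neg
  · filter_upwards [h0] with ω hω v hv
    rw [norm_neg]
    refine (norm_deriv_log_base_le hω (hv.trans hθ2)).trans ?_
    have hv' : |v.im| < θ := hv
    refine inv_anti₀ (cos_half_pos (by rwa [abs_of_nonneg hθ0])) ?_
    rw [← Real.cos_abs (v.im / 2), abs_div, abs_two]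
    exact Real.cos_le_cos_of_nonneg_of_le_pi (by positivity) (by linarith) (by linarith)
  · filter_upwards [h0] with ω hω v hv
    exact hasDerivAt_log_base hω (lt_trans hv hθ2)

theorem differentiableOn_factor [IsFiniteMeasure μ] (hg : AEMeasurable g μ)
    (h0 : ∀ᵐ ω ∂μ, 0 ≤ g ω) (hlog : Integrable (fun ω => Real.log (1 + g ω)) μ) :
    DifferentiableOn ℂ (factor μ g) {w : ℂ | |w.im| < Real.pi} := fun _ hw =>
  ((differentiableAt_logPotential hg h0 hlog hw).neg.cexp).differentiableWithinAt

theorem factor_real_im (x : ℝ) (h0 : ∀ᵐ ω ∂μ, 0 ≤ g ω) : (factor μ g x).im = 0 := by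
  have h : logPotential μ g x = ((∫ ω, Real.log (1 + g ω * Real.exp (-x)) ∂μ : ℝ) : ℂ) := by
    rw [logPotential, ← integral_complex_ofReal]
    refine integral_congr_ae ?_
    filter_upwards [h0] with ω hω
    rw [Complex.ofReal_log (by positivity)]
    simp [base]
  rw [factor, h, ← Complex.ofReal_neg, ← Complex.ofReal_exp, Complex.ofReal_im]

theorem norm_factor [IsFiniteMeasure μ] (hg : AEMeasurable g μ)
    (h0 : ∀ᵐ ω ∂μ, 0 ≤ g ω) (hlog : Integrable (fun ω => Real.log (1 + g ω)) μ) {w : ℂ}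
    (hw : |w.im| < Real.pi) :
    ‖factor μ g w‖ = Real.exp (-∫ ω, Real.log ‖base (g ω) w‖ ∂μ) := by
  rw [factor, Complex.norm_exp, Complex.neg_re, logPotential]
  congr 2
  have := integral_re (𝕜 := ℂ) (integrable_log_base hg h0 hlog hw)
  simp only [RCLike.re_to_complex, Complex.log_re] at this
  exact this.symm

theorem integrable_log_norm_base [IsFiniteMeasure μ] (hg : AEMeasurable g μ)
    (h0 : ∀ᵐ ω ∂μ, 0 ≤ g ω) (hlog : Integrable (fun ω => Real.log (1 + g ω)) μ) {w : ℂ}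
    (hw : |w.im| < Real.pi) :
    Integrable (fun ω => Real.log ‖base (g ω) w‖) μ := by
  have := (integrable_log_base hg h0 hlog hw).re
  simpa only [RCLike.re_to_complex, Complex.log_re] using this

/-- Cauchy's theorem for the rectangle `[a, b] × [0, θ]`; the lower side contributes a real
number. -/
theorem integral_im_factor [IsFiniteMeasure μ] (hg : AEMeasurable g μ)
    (h0 : ∀ᵐ ω ∂μ, 0 ≤ g ω) (hlog : Integrable (fun ω => Real.log (1 + g ω)) μ)
    (a b : ℝ) {θ : ℝ} (hθ0 : 0 ≤ θ) (hθ : θ < Real.pi) :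
    ∫ x in a..b, (factor μ g (x + θ * Complex.I)).im =
      (∫ y in (0 : ℝ)..θ, (factor μ g (b + y * Complex.I)).re) -
        ∫ y in (0 : ℝ)..θ, (factor μ g (a + y * Complex.I)).re := by
  have hd := differentiableOn_factor hg h0 hlog
  have hc := hd.continuousOn
  have hR := Complex.integral_boundary_rect_eq_zero_of_differentiableOn (factor μ g) a
    (b + θ * Complex.I) (hd.mono ?_)
  swap
  · intro w hw
    have := hw.2
    simp only [Complex.ofReal_im, Complex.add_im, Complex.mul_im, Complex.ofReal_re,
      Complex.I_im, mul_one, Complex.I_re, mul_zero, add_zero, zero_add, uIcc_of_le hθ0,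
      mem_preimage, mem_Icc] at this
    rw [mem_ofPred_eq, abs_of_nonneg this.1]
    exact this.2.trans_lt hθ
  simp only [Complex.ofReal_re, Complex.ofReal_im, Complex.add_re, Complex.mul_re, Complex.I_re,
    mul_zero, Complex.I_im, mul_one, sub_self, add_zero, Complex.add_im, Complex.mul_im,
    zero_add, Complex.ofReal_zero, zero_mul, smul_eq_mul] at hR
  have hcx : ∀ y : ℝ, |y| < Real.pi → ∀ c d : ℝ,
      IntervalIntegrable (fun x : ℝ => factor μ g (x + y * Complex.I)) volume c d := by
    intro y hy c d
    refine ContinuousOn.intervalIntegrable (hc.comp (by fun_prop) fun x _ => ?_)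
    simpa using hy
  have hcy : ∀ x : ℝ,
      IntervalIntegrable (fun y : ℝ => factor μ g (x + y * Complex.I)) volume 0 θ := by
    intro x
    refine ContinuousOn.intervalIntegrable (hc.comp (by fun_prop) fun y hy => ?_)
    rw [uIcc_of_le hθ0] at hy
    simpa [abs_of_nonneg hy.1] using hy.2.trans_lt hθ
  have key : ∀ (f : ℝ → ℂ) (c d : ℝ), IntervalIntegrable f volume c d →
      (∫ x in c..d, f x).im = ∫ x in c..d, (f x).im := fun f c d hf =>
    (Complex.imCLM.intervalIntegral_comp_comm hf).symm
  have key' : ∀ (f : ℝ → ℂ) (c d : ℝ), IntervalIntegrable f volume c d →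
      (∫ x in c..d, f x).re = ∫ x in c..d, (f x).re := fun f c d hf =>
    (Complex.reCLM.intervalIntegral_comp_comm hf).symm
  have him := congrArg Complex.im hR
  simp only [Complex.add_im, Complex.sub_im, Complex.mul_im, Complex.I_re, Complex.I_im,
    zero_mul, one_mul, zero_add, Complex.zero_im] at him
  rw [key' _ _ _ (hcy b), key' _ _ _ (hcy a), key _ _ _ (hcx θ (by rwa [abs_of_nonneg hθ0]) a b)]
    at him
  have hz := key _ _ _ (hcx 0 (by simpa using Real.pi_pos) a b)
  simp only [Complex.ofReal_zero, zero_mul, add_zero, factor_real_im _ h0,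
    intervalIntegral.integral_zero] at hz
  rw [hz] at him
  linarith

theorem sub_div_pi_le_cos_half {y : ℝ} (h0 : 0 ≤ y) (h1 : y ≤ Real.pi) :
    (Real.pi - y) / Real.pi ≤ Real.cos (y / 2) := by
  have := Real.mul_le_sin (x := (Real.pi - y) / 2) (by linarith) (by linarith)
  rw [show (Real.pi - y) / 2 = Real.pi / 2 - y / 2 by ring, Real.sin_pi_div_two_sub] at this
  refine le_trans (le_of_eq ?_) this
  field_simp

/-- If `|1 - g e^{-x}| ≥ c` on a set `S` of mass `p > 0`, then on the circle `|z| = e^x` the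
factor is at most a power of the distance to the cut, with exponent better than `-1`. -/
theorem norm_factor_le [IsProbabilityMeasure μ] (hg : AEMeasurable g μ)
    (h0 : ∀ᵐ ω ∂μ, 0 ≤ g ω) (hlog : Integrable (fun ω => Real.log (1 + g ω)) μ)
    {S : Set Ω} (hS : MeasurableSet S) {c x : ℝ} (hc : 0 < c)
    (hcS : ∀ᵐ ω ∂μ, ω ∈ S → c ≤ |1 - g ω * Real.exp (-x)|)
    {y : ℝ} (hy0 : 0 ≤ y) (hy : y < Real.pi) :
    ‖factor μ g (x + y * Complex.I)‖ ≤
      c ^ (-(μ.real S)) * ((Real.pi - y) / Real.pi) ^ (-(1 - μ.real S)) := by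
  have hw : |(x + y * Complex.I : ℂ).im| < Real.pi := by simpa [abs_of_nonneg hy0] using hy
  have hd : 0 < (Real.pi - y) / Real.pi := div_pos (by linarith) Real.pi_pos
  rw [norm_factor hg h0 hlog hw, Real.rpow_def_of_pos hc, Real.rpow_def_of_pos hd, ← Real.exp_add,
    Real.exp_le_exp]
  -- Use the lower bound `c` for `|1 + g / z|` on `S`, and the distance to the cut off `S`.
  have hle : ∫ ω, (S.indicator (fun _ => Real.log c) ω +
      Sᶜ.indicator (fun _ => Real.log ((Real.pi - y) / Real.pi)) ω) ∂μ ≤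
      ∫ ω, Real.log ‖base (g ω) (x + y * Complex.I)‖ ∂μ := by
    refine integral_mono_ae ?_ (integrable_log_norm_base hg h0 hlog hw) ?_
    · exact ((integrable_const _).indicator hS).add ((integrable_const _).indicator hS.compl)
    · filter_upwards [h0, hcS] with ω hω hωc
      by_cases hmem : ω ∈ S
      · simp only [indicator_of_mem hmem, indicator_of_notMem (notMem_compl_iff.2 hmem), add_zero]
        refine Real.log_le_log hc ((hωc hmem).trans ?_)
        simpa using abs_one_sub_le_norm_base hω (x + y * Complex.I)
      · simp only [indicator_of_notMem hmem, indicator_of_mem (mem_compl hmem), zero_add]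
        refine Real.log_le_log hd ((sub_div_pi_le_cos_half hy0 hy.le).trans ?_)
        have h1 := cos_half_mul_le_norm_base hω (x + y * Complex.I)
        have h2 := cos_half_pos hw
        refine le_trans ?_ h1
        have h3 : (x + y * Complex.I : ℂ).im = y := by simp
        rw [h3] at h2 ⊢
        have : 0 ≤ g ω * Real.exp (-(x + y * Complex.I : ℂ).re) := by positivity
        nlinarith
  rw [integral_add ((integrable_const _).indicator hS) ((integrable_const _).indicator hS.compl),
    integral_indicator_const _ hS, integral_indicator_const _ hS.compl,
    probReal_compl_eq_one_sub hS, smul_eq_mul, smul_eq_mul] at hle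
  linarith

theorem intervalIntegrable_rpow_bound (c : ℝ) {p : ℝ} (hp : 0 < p) :
    IntervalIntegrable (fun y => c ^ (-p) * ((Real.pi - y) / Real.pi) ^ (-(1 - p))) volume 0
      Real.pi := by
  refine IntervalIntegrable.const_mul ?_ _
  have h := (intervalIntegral.intervalIntegrable_rpow' (a := 1) (b := 0) (r := -(1 - p))
    (by linarith))
  have h2 := (h.comp_sub_left 1).comp_mul_left (c := (Real.pi)⁻¹)
  have hpi := Real.pi_ne_zero
  simp only [sub_self, sub_zero, div_inv_eq_mul, one_mul, zero_mul] at h2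
  refine h2.congr_ae (Eventually.of_forall fun y => ?_)
  simp only
  congr 1
  field_simp

/-! ### Arc integrals and boundary values on the cut -/

theorem continuousOn_factor_arc [IsFiniteMeasure μ] (hg : AEMeasurable g μ)
    (h0 : ∀ᵐ ω ∂μ, 0 ≤ g ω) (hlog : Integrable (fun ω => Real.log (1 + g ω)) μ) (x : ℝ) :
    ContinuousOn (fun y : ℝ => factor μ g (x + y * Complex.I)) (Ioo 0 Real.pi) := by
  refine (differentiableOn_factor hg h0 hlog).continuousOn.comp (by fun_prop) fun y hy => ?_
  simpa [abs_of_pos hy.1] using hy.2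

theorem continuous_factor_line [IsFiniteMeasure μ] (hg : AEMeasurable g μ)
    (h0 : ∀ᵐ ω ∂μ, 0 ≤ g ω) (hlog : Integrable (fun ω => Real.log (1 + g ω)) μ) {y : ℝ}
    (hy : |y| < Real.pi) :
    Continuous (fun x : ℝ => factor μ g (x + y * Complex.I)) := by
  rw [← continuousOn_univ]
  refine (differentiableOn_factor hg h0 hlog).continuousOn.comp (by fun_prop) fun x _ => ?_
  simpa using hy

theorem aestronglyMeasurable_factor_arc [IsFiniteMeasure μ] (hg : AEMeasurable g μ)
    (h0 : ∀ᵐ ω ∂μ, 0 ≤ g ω) (hlog : Integrable (fun ω => Real.log (1 + g ω)) μ) (x : ℝ) :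
    AEStronglyMeasurable (fun y : ℝ => factor μ g (x + y * Complex.I))
      (volume.restrict (uIoc 0 Real.pi)) := by
  rw [uIoc_of_le Real.pi_pos.le, ← restrict_Ioo_eq_restrict_Ioc]
  exact (continuousOn_factor_arc hg h0 hlog x).aestronglyMeasurable measurableSet_Ioo

theorem ae_ne_pi : ∀ᵐ y : ℝ, y ≠ Real.pi := by simp [ae_iff]

theorem intervalIntegrable_factor_arc [IsProbabilityMeasure μ] (hg : AEMeasurable g μ)
    (h0 : ∀ᵐ ω ∂μ, 0 ≤ g ω) (hlog : Integrable (fun ω => Real.log (1 + g ω)) μ)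
    {S : Set Ω} (hS : MeasurableSet S) (hSpos : 0 < μ.real S) {c x : ℝ} (hc : 0 < c)
    (hcS : ∀ᵐ ω ∂μ, ω ∈ S → c ≤ |1 - g ω * Real.exp (-x)|) :
    IntervalIntegrable (fun y : ℝ => factor μ g (x + y * Complex.I)) volume 0 Real.pi := by
  refine (intervalIntegrable_rpow_bound c hSpos).mono_fun'
    (aestronglyMeasurable_factor_arc hg h0 hlog x) ?_
  rw [uIoc_of_le Real.pi_pos.le, ← restrict_Ioo_eq_restrict_Ioc]
  filter_upwards [ae_restrict_mem measurableSet_Ioo] with y hy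
  exact norm_factor_le hg h0 hlog hS hc hcS hy.1.le hy.2

/-- The arc integral is the limit of the integrals over arcs that stop short of the cut. -/
theorem tendsto_integral_arc [IsProbabilityMeasure μ] (hg : AEMeasurable g μ)
    (h0 : ∀ᵐ ω ∂μ, 0 ≤ g ω) (hlog : Integrable (fun ω => Real.log (1 + g ω)) μ)
    {S : Set Ω} (hS : MeasurableSet S) (hSpos : 0 < μ.real S) {c x : ℝ} (hc : 0 < c)
    (hcS : ∀ᵐ ω ∂μ, ω ∈ S → c ≤ |1 - g ω * Real.exp (-x)|) :
    Tendsto (fun θ => ∫ y in (0 : ℝ)..θ, (factor μ g (x + y * Complex.I)).re) (𝓝[<] Real.pi)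
      (𝓝 (arcIntegral μ g x)) := by
  have hi : IntervalIntegrable (fun y : ℝ => (factor μ g (x + y * Complex.I)).re) volume 0
      Real.pi := by
    have := intervalIntegrable_factor_arc hg h0 hlog hS hSpos hc hcS
    exact ⟨this.1.re, this.2.re⟩
  have hI : IntegrableOn (fun y : ℝ => (factor μ g (x + y * Complex.I)).re) (uIcc 0 Real.pi) := by
    rw [uIcc_of_le Real.pi_pos.le]
    exact (intervalIntegrable_iff_integrableOn_Icc_of_le Real.pi_pos.le).1 hi
  have hcont := intervalIntegral.continuousOn_primitive_interval hI Real.pi right_mem_uIcc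
  have hmono : 𝓝[<] Real.pi ≤ 𝓝[uIcc 0 Real.pi] Real.pi := by
    rw [uIcc_of_le Real.pi_pos.le, nhdsWithin_Icc_eq_nhdsLE Real.pi_pos]
    exact nhdsWithin_mono _ Iio_subset_Iic_self
  exact hcont.tendsto.mono_left hmono

/-- Dominated convergence on the arcs, for radii that keep `g / |z|` away from `1` on a fixed set of
positive mass. -/
theorem tendsto_arcIntegral [IsProbabilityMeasure μ] (hg : AEMeasurable g μ)
    (h0 : ∀ᵐ ω ∂μ, 0 ≤ g ω) (hlog : Integrable (fun ω => Real.log (1 + g ω)) μ)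
    {S : Set Ω} (hS : MeasurableSet S) (hSpos : 0 < μ.real S) {c : ℝ} (hc : 0 < c)
    {l : Filter ℝ} [l.IsCountablyGenerated]
    (hcS : ∀ᶠ x in l, ∀ᵐ ω ∂μ, ω ∈ S → c ≤ |1 - g ω * Real.exp (-x)|) {f : ℝ → ℂ}
    (hf : ∀ y ∈ Ioo 0 Real.pi,
      Tendsto (fun x : ℝ => factor μ g (x + y * Complex.I)) l (𝓝 (f y))) :
    Tendsto (arcIntegral μ g) l (𝓝 (∫ y in (0 : ℝ)..Real.pi, (f y).re)) := by
  unfold arcIntegral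
  refine intervalIntegral.tendsto_integral_filter_of_dominated_convergence _
    (Eventually.of_forall fun x => ?_) ?_ (intervalIntegrable_rpow_bound c hSpos) ?_
  · exact Complex.continuous_re.comp_aestronglyMeasurable
      (aestronglyMeasurable_factor_arc hg h0 hlog x)
  · filter_upwards [hcS] with x hx
    filter_upwards [ae_ne_pi] with y hy hmem
    rw [uIoc_of_le Real.pi_pos.le] at hmem
    refine (Complex.abs_re_le_norm _).trans ?_
    exact norm_factor_le hg h0 hlog hS hc hx hmem.1.le (lt_of_le_of_ne hmem.2 hy)
  · filter_upwards [ae_ne_pi] with y hy hmem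
    rw [uIoc_of_le Real.pi_pos.le] at hmem
    exact (Complex.continuous_re.tendsto _).comp (hf y ⟨hmem.1, lt_of_le_of_ne hmem.2 hy⟩)

theorem tendsto_factor_atTop [IsFiniteMeasure μ] (hg : AEMeasurable g μ)
    (h0 : ∀ᵐ ω ∂μ, 0 ≤ g ω) (hlog : Integrable (fun ω => Real.log (1 + g ω)) μ) {y : ℝ}
    (hy : |y| < Real.pi) :
    Tendsto (fun x : ℝ => factor μ g (x + y * Complex.I)) atTop (𝓝 1) := by
  have h : Tendsto (fun x : ℝ => logPotential μ g (x + y * Complex.I)) atTop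
      (𝓝 (∫ _, (0 : ℂ) ∂μ)) := by
    refine tendsto_integral_filter_of_dominated_convergence
      (fun ω => Real.log (1 + g ω) + 0 - Real.log (Real.cos (y / 2)) + Real.pi)
      (Eventually.of_forall fun x => aestronglyMeasurable_log_base hg _) ?_
      (((hlog.add (integrable_const _)).sub (integrable_const _)).add (integrable_const _)) ?_
    · filter_upwards [eventually_ge_atTop 0] with x hx
      filter_upwards [h0] with ω hω
      have := norm_log_base_le hω (w := x + y * Complex.I) (by simpa using hy)
      simpa [hx] using this
    · refine Eventually.of_forall fun ω => ?_
      have hb : Tendsto (fun x : ℝ => base (g ω) (x + y * Complex.I)) atTop (𝓝 (1 + g ω * 0)) := by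
        unfold base
        refine (Tendsto.const_mul _ ?_).const_add 1
        rw [tendsto_zero_iff_norm_tendsto_zero]
        have : ∀ x : ℝ, ‖Complex.exp (-(x + y * Complex.I))‖ = Real.exp (-x) := fun x => by
          rw [Complex.norm_exp]; simp
        simp only [this]
        exact Real.tendsto_exp_neg_atTop_nhds_zero
      rw [mul_zero, add_zero] at hb
      have := hb.clog (by simp)
      simpa using this
  rw [integral_zero] at h
  have := (Complex.continuous_exp.tendsto _).comp h.neg
  simpa [factor, Function.comp_def] using this

/-- As `|z| → ∞` the factor tends to `1`. -/
theorem tendsto_arcIntegral_atTop [IsProbabilityMeasure μ] (hg : AEMeasurable g μ)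
    (h0 : ∀ᵐ ω ∂μ, 0 ≤ g ω) (hlog : Integrable (fun ω => Real.log (1 + g ω)) μ)
    {S : Set Ω} (hS : MeasurableSet S) (hSpos : 0 < μ.real S) {s : ℝ}
    (hs : ∀ᵐ ω ∂μ, ω ∈ S → g ω ≤ s) :
    Tendsto (arcIntegral μ g) atTop (𝓝 Real.pi) := by
  have := tendsto_arcIntegral hg h0 hlog hS hSpos (c := 1 / 2) (by norm_num) (l := atTop)
    (f := fun _ => 1) ?_ fun y hy => tendsto_factor_atTop hg h0 hlog
      (by rw [abs_of_pos hy.1]; exact hy.2)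
  · simpa using this
  have ht : Tendsto (fun x => s * Real.exp (-x)) atTop (𝓝 (s * 0)) :=
    Real.tendsto_exp_neg_atTop_nhds_zero.const_mul s
  rw [mul_zero] at ht
  filter_upwards [ht.eventually_lt_const (by norm_num : (0 : ℝ) < 1 / 2)] with x hx
  filter_upwards [hs] with ω hω hmem
  have := mul_le_mul_of_nonneg_right (hω hmem) (Real.exp_pos (-x)).le
  exact le_trans (by linarith) (le_abs_self _)

/-- As `z → 0` the factor tends to `0`. -/
theorem tendsto_arcIntegral_atBot [IsProbabilityMeasure μ] (hg : AEMeasurable g μ)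
    (h0 : ∀ᵐ ω ∂μ, 0 ≤ g ω) (hlog : Integrable (fun ω => Real.log (1 + g ω)) μ)
    {S : Set Ω} (hS : MeasurableSet S) (hSpos : 0 < μ.real S) {s : ℝ} (hs0 : 0 < s)
    (hs : ∀ᵐ ω ∂μ, ω ∈ S → s ≤ g ω) :
    Tendsto (arcIntegral μ g) atBot (𝓝 0) := by
  have ht : Tendsto (fun x => s * Real.exp (-x) - 1) atBot atTop :=
    tendsto_atTop_add_const_right _ _
      ((Real.tendsto_exp_atTop.comp tendsto_neg_atBot_atTop).const_mul_atTop hs0)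
  have hb : ∀ x, ∀ᵐ ω ∂μ, ω ∈ S → s * Real.exp (-x) - 1 ≤ |1 - g ω * Real.exp (-x)| := by
    intro x
    filter_upwards [hs] with ω hω hmem
    have := mul_le_mul_of_nonneg_right (hω hmem) (Real.exp_pos (-x)).le
    rw [abs_sub_comm]
    exact le_trans (by linarith) (le_abs_self _)
  have := tendsto_arcIntegral hg h0 hlog hS hSpos (c := 1) one_pos (l := atBot)
    (f := fun _ => 0) ?_ fun y hy => ?_
  · simpa using this
  · filter_upwards [ht.eventually_ge_atTop 1] with x hx
    filter_upwards [hb x] with ω hω hmem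
    exact hx.trans (hω hmem)
  · have hz : Tendsto (fun x => (s * Real.exp (-x) - 1) ^ (-(μ.real S)) *
        ((Real.pi - y) / Real.pi) ^ (-(1 - μ.real S))) atBot (𝓝 (0 * _)) :=
      ((tendsto_rpow_neg_atTop hSpos).comp ht).mul_const _
    rw [zero_mul] at hz
    refine squeeze_zero_norm' ?_ hz
    filter_upwards [ht.eventually_gt_atTop 0] with x hx
    exact norm_factor_le hg h0 hlog hS hx (hb x) hy.1.le hy.2

/-- The modulus of the boundary value dominates the factor on the whole arc: the dominating
function for the limit at the cut. -/
theorem norm_factor_le_boundary [IsFiniteMeasure μ] (hg : AEMeasurable g μ)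
    (h0 : ∀ᵐ ω ∂μ, 0 ≤ g ω) (hlog : Integrable (fun ω => Real.log (1 + g ω)) μ) {x : ℝ}
    (hne : ∀ᵐ ω ∂μ, g ω * Real.exp (-x) ≠ 1)
    (hint : Integrable (fun ω => Real.log |1 - g ω * Real.exp (-x)|) μ) {θ : ℝ}
    (hθ : |θ| < Real.pi) :
    ‖factor μ g (x + θ * Complex.I)‖ ≤
      Real.exp (-∫ ω, Real.log |1 - g ω * Real.exp (-x)| ∂μ) := by
  have hw : |(x + θ * Complex.I : ℂ).im| < Real.pi := by simpa using hθ
  rw [norm_factor hg h0 hlog hw, Real.exp_le_exp, neg_le_neg_iff]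
  refine integral_mono_ae hint (integrable_log_norm_base hg h0 hlog hw) ?_
  filter_upwards [h0, hne] with ω hω hωne
  refine Real.log_le_log (abs_pos.2 (sub_ne_zero.2 hωne.symm)) ?_
  simpa using abs_one_sub_le_norm_base hω (x + θ * Complex.I)

theorem tendsto_base_boundary (t x : ℝ) :
    Tendsto (fun θ : ℝ => base t (x + θ * Complex.I)) (𝓝[<] Real.pi)
      (𝓝 ((1 - t * Real.exp (-x) : ℝ) : ℂ)) := by
  have h : ContinuousAt (fun θ : ℝ => base t (x + θ * Complex.I)) Real.pi := by
    unfold base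
    fun_prop
  have hv : base t (x + Real.pi * Complex.I) = ((1 - t * Real.exp (-x) : ℝ) : ℂ) := by
    have e1 : (x + Real.pi * Complex.I : ℂ).re = x := by simp
    have e2 : (x + Real.pi * Complex.I : ℂ).im = Real.pi := by simp
    apply Complex.ext
    · rw [base_re, e1, e2, Real.cos_pi, Complex.ofReal_re]; ring
    · rw [base_im, e1, e2, Real.sin_pi, Complex.ofReal_im]; ring
  rw [← hv]
  exact h.tendsto.mono_left nhdsWithin_le_nhds

/-- The boundary values of `log (1 + t / z)` on the upper side of the cut: the argument is `0` for
`t < |z|` and `-π` for `t > |z|`. -/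
theorem tendsto_log_base_boundary {t x : ℝ} (hne : t * Real.exp (-x) ≠ 1) :
    Tendsto (fun θ : ℝ => Complex.log (base t (x + θ * Complex.I))) (𝓝[<] Real.pi)
      (𝓝 ((Real.log |1 - t * Real.exp (-x)| : ℝ) -
        (if 1 < t * Real.exp (-x) then Real.pi else 0 : ℝ) * Complex.I)) := by
  have hb := tendsto_base_boundary t x
  by_cases h : 1 < t * Real.exp (-x)
  · rw [if_pos h]
    have h1 := Complex.tendsto_log_nhdsWithin_im_neg_of_re_neg_of_im_zero
      (z := ((1 - t * Real.exp (-x) : ℝ) : ℂ)) (by rw [Complex.ofReal_re]; linarith)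
      (Complex.ofReal_im _)
    rw [Complex.norm_real, Real.norm_eq_abs] at h1
    refine h1.comp (tendsto_nhdsWithin_iff.2 ⟨hb, ?_⟩)
    have hpos : ∀ᶠ θ : ℝ in 𝓝[<] Real.pi, 0 < θ :=
      nhdsWithin_le_nhds (lt_mem_nhds Real.pi_pos)
    filter_upwards [hpos, self_mem_nhdsWithin] with θ h1 h2
    rw [base_im]
    have hs := Real.sin_pos_of_pos_of_lt_pi h1 h2
    have : 0 < t * Real.exp (-x) := by linarith
    simp only [Complex.add_re, Complex.add_im, Complex.ofReal_re, Complex.ofReal_im,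
      Complex.mul_re, Complex.mul_im, Complex.I_re, Complex.I_im, mul_zero, mul_one, sub_self,
      add_zero, zero_add]
    nlinarith [mul_pos this hs]
  · rw [if_neg h]
    have hlt : 0 < 1 - t * Real.exp (-x) := by
      rcases lt_or_eq_of_le (not_lt.1 h) with h' | h'
      · linarith
      · exact absurd h' hne
    have := hb.clog (Complex.ofReal_mem_slitPlane.2 hlt)
    rw [← Complex.ofReal_log hlt.le] at this
    simpa [abs_of_pos hlt] using this

/-- The boundary values of the factor on the upper side of the cut. -/
theorem tendsto_factor_boundary [IsFiniteMeasure μ] (hg : AEMeasurable g μ)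
    (h0 : ∀ᵐ ω ∂μ, 0 ≤ g ω) (hlog : Integrable (fun ω => Real.log (1 + g ω)) μ) {x : ℝ}
    (hne : ∀ᵐ ω ∂μ, g ω * Real.exp (-x) ≠ 1)
    (hint : Integrable (fun ω => Real.log |1 - g ω * Real.exp (-x)|) μ) :
    Tendsto (fun θ : ℝ => factor μ g (x + θ * Complex.I)) (𝓝[<] Real.pi)
      (𝓝 (Real.exp (-∫ ω, Real.log |1 - g ω * Real.exp (-x)| ∂μ) *
        Complex.exp ((Real.pi * μ.real {ω | 1 < g ω * Real.exp (-x)} : ℝ) * Complex.I))) := by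
  have hset : NullMeasurableSet {ω | 1 < g ω * Real.exp (-x)} μ :=
    nullMeasurableSet_lt aemeasurable_const (hg.mul_const _)
  have hind : (fun ω => (if 1 < g ω * Real.exp (-x) then Real.pi else 0 : ℝ)) =
      {ω | 1 < g ω * Real.exp (-x)}.indicator (fun _ => Real.pi) := by
    ext ω
    simp [indicator]
  have hi2 : Integrable (fun ω => (if 1 < g ω * Real.exp (-x) then Real.pi else 0 : ℝ)) μ := by
    rw [hind]
    exact (integrable_const _).indicator₀ hset
  have hv : ∫ ω, ((Real.log |1 - g ω * Real.exp (-x)| : ℝ) -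
        (if 1 < g ω * Real.exp (-x) then Real.pi else 0 : ℝ) * Complex.I : ℂ) ∂μ =
      (∫ ω, Real.log |1 - g ω * Real.exp (-x)| ∂μ : ℝ) -
        (Real.pi * μ.real {ω | 1 < g ω * Real.exp (-x)} : ℝ) * Complex.I := by
    rw [integral_sub hint.ofReal (hi2.ofReal.mul_const _), integral_mul_const,
      integral_complex_ofReal, integral_complex_ofReal, hind, integral_indicator₀ hset,
      setIntegral_const, smul_eq_mul, mul_comm Real.pi]
  have h : Tendsto (fun θ : ℝ => logPotential μ g (x + θ * Complex.I)) (𝓝[<] Real.pi)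
      (𝓝 (∫ ω, ((Real.log |1 - g ω * Real.exp (-x)| : ℝ) -
        (if 1 < g ω * Real.exp (-x) then Real.pi else 0 : ℝ) * Complex.I : ℂ) ∂μ)) := by
    refine tendsto_integral_filter_of_dominated_convergence
      (fun ω => |(Real.log |1 - g ω * Real.exp (-x)|)| + Real.log ‖base (g ω) (x : ℂ)‖ + Real.pi)
      (Eventually.of_forall fun x => aestronglyMeasurable_log_base hg _) ?_
      ((hint.abs.add (integrable_log_norm_base hg h0 hlog (by simpa using Real.pi_pos))).add
        (integrable_const _)) ?_
    · have hpos : ∀ᶠ θ : ℝ in 𝓝[<] Real.pi, 0 < θ :=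
        nhdsWithin_le_nhds (lt_mem_nhds Real.pi_pos)
      filter_upwards [hpos, self_mem_nhdsWithin] with θ h1 h2
      filter_upwards [h0, hne] with ω hω hωne
      refine (norm_log_le _).trans ?_
      gcongr
      have hr : 0 ≤ g ω * Real.exp (-x) := by positivity
      have hbx : ‖base (g ω) (x : ℂ)‖ = 1 + g ω * Real.exp (-x) := by
        have : base (g ω) (x : ℂ) = ((1 + g ω * Real.exp (-x) : ℝ) : ℂ) := by simp [base]
        rw [this, Complex.norm_real, Real.norm_of_nonneg (by linarith)]
      have hp : 0 < |1 - g ω * Real.exp (-x)| := abs_pos.2 (sub_ne_zero.2 hωne.symm)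
      have hlo : |1 - g ω * Real.exp (-x)| ≤ ‖base (g ω) (x + θ * Complex.I)‖ := by
        simpa using abs_one_sub_le_norm_base hω (x + θ * Complex.I)
      have hup : ‖base (g ω) (x + θ * Complex.I)‖ ≤ 1 + g ω * Real.exp (-x) := by
        simpa using norm_base_le hω (x + θ * Complex.I)
      rw [hbx]
      have e1 := Real.log_le_log hp hlo
      have e2 := Real.log_le_log (hp.trans_le hlo) hup
      have e3 : 0 ≤ Real.log (1 + g ω * Real.exp (-x)) := Real.log_nonneg (by linarith)
      have e4 := neg_abs_le (Real.log |1 - g ω * Real.exp (-x)|)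
      have e5 := abs_nonneg (Real.log |1 - g ω * Real.exp (-x)|)
      rw [abs_le]
      constructor <;> linarith
    · filter_upwards [hne] with ω hωne
      exact tendsto_log_base_boundary hωne
  rw [hv] at h
  have := (Complex.continuous_exp.tendsto _).comp h.neg
  rw [neg_sub, sub_eq_neg_add, Complex.exp_add, ← Complex.ofReal_neg, ← Complex.ofReal_exp] at this
  exact this

/-- Outside the disc that contains the cut, the arc integral does not depend on the radius. -/
theorem arcIntegral_eq_of_bounded [IsProbabilityMeasure μ] (hg : AEMeasurable g μ)
    (h0 : ∀ᵐ ω ∂μ, 0 ≤ g ω) (hlog : Integrable (fun ω => Real.log (1 + g ω)) μ) {M : ℝ}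
    (hM0 : 0 < M) (hM : ∀ᵐ ω ∂μ, g ω ≤ M) {a b : ℝ} (ha : Real.log M < a) (hab : a ≤ b) :
    arcIntegral μ g b = arcIntegral μ g a := by
  have hc : 0 < 1 - M * Real.exp (-a) := by
    have : M < Real.exp a := (Real.log_lt_iff_lt_exp hM0).1 ha
    rw [Real.exp_neg, ← div_eq_mul_inv, sub_pos, div_lt_one (Real.exp_pos a)]
    exact this
  have hcx : ∀ x, a ≤ x → ∀ᵐ ω ∂μ, 1 - M * Real.exp (-a) ≤ 1 - g ω * Real.exp (-x) := by
    intro x hx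
    filter_upwards [h0, hM] with ω hω hωM
    have : g ω * Real.exp (-x) ≤ M * Real.exp (-a) := by gcongr
    linarith
  have hcS : ∀ x, a ≤ x → ∀ᵐ ω ∂μ, ω ∈ (univ : Set Ω) →
      1 - M * Real.exp (-a) ≤ |1 - g ω * Real.exp (-x)| := by
    intro x hx
    filter_upwards [hcx x hx] with ω hω _
    exact hω.trans (le_abs_self _)
  have huniv : 0 < μ.real (univ : Set Ω) := by simp
  have hlim := (tendsto_integral_arc hg h0 hlog MeasurableSet.univ huniv hc (hcS b hab)).sub
    (tendsto_integral_arc hg h0 hlog MeasurableSet.univ huniv hc (hcS a le_rfl))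
  have hpos : ∀ᶠ θ : ℝ in 𝓝[<] Real.pi, 0 < θ :=
    nhdsWithin_le_nhds (lt_mem_nhds Real.pi_pos)
  have hzero : Tendsto (fun θ : ℝ => ∫ x in a..b, (factor μ g (x + θ * Complex.I)).im)
      (𝓝[<] Real.pi) (𝓝 (∫ _ in a..b, (0 : ℝ))) := by
    refine intervalIntegral.tendsto_integral_filter_of_dominated_convergence
      (fun _ => (1 - M * Real.exp (-a)) ^ (-(1 : ℝ))) ?_ ?_ intervalIntegrable_const ?_
    · filter_upwards [hpos, self_mem_nhdsWithin] with θ h1 h2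
      exact (Complex.continuous_im.comp (continuous_factor_line hg h0 hlog
        (by rw [abs_of_pos h1]; exact h2))).aestronglyMeasurable
    · filter_upwards [hpos, self_mem_nhdsWithin] with θ h1 h2
      refine Eventually.of_forall fun x hx => (Complex.abs_im_le_norm _).trans ?_
      rw [uIoc_of_le hab] at hx
      simpa using norm_factor_le hg h0 hlog MeasurableSet.univ hc (hcS x hx.1.le) h1.le h2
    · refine Eventually.of_forall fun x hx => ?_
      rw [uIoc_of_le hab] at hx
      have hx' := hcx x hx.1.le
      have hnull : μ.real {ω | 1 < g ω * Real.exp (-x)} = 0 := by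
        rw [measureReal_eq_zero_iff, ← nonpos_iff_eq_zero]
        refine le_of_eq (measure_eq_zero_iff_ae_notMem.2 ?_)
        filter_upwards [hx'] with ω hω
        simp only [not_lt]
        linarith
      have := tendsto_factor_boundary hg h0 hlog (x := x)
        (by filter_upwards [hx'] with ω hω
            exact fun h => by linarith) ?_
      · rw [hnull] at this
        have h2 := (Complex.continuous_im.tendsto _).comp this
        simpa only [Function.comp_def, mul_zero, Complex.ofReal_zero, zero_mul, Complex.exp_zero,
          mul_one, Complex.ofReal_im] using h2
      · refine Integrable.of_bound (C := |Real.log (1 - M * Real.exp (-a))|) ?_ ?_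
        · exact (Real.measurable_log.comp_aemeasurable
            (continuous_abs.measurable.comp_aemeasurable
              ((hg.mul_const _).const_sub 1))).aestronglyMeasurable
        · filter_upwards [hx', h0] with ω hω hω0
          have h1 : 0 < 1 - g ω * Real.exp (-x) := hc.trans_le hω
          have h2 : 0 ≤ g ω * Real.exp (-x) := by positivity
          rw [abs_of_pos h1, Real.norm_eq_abs, abs_of_nonpos (Real.log_nonpos h1.le (by linarith))]
          exact le_trans (neg_le_neg (Real.log_le_log hc hω)) (neg_le_abs _)
  rw [intervalIntegral.integral_zero] at hzero
  have heq : ∀ᶠ θ : ℝ in 𝓝[<] Real.pi,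
      ∫ x in a..b, (factor μ g (x + θ * Complex.I)).im =
      (∫ y in (0 : ℝ)..θ, (factor μ g (b + y * Complex.I)).re) -
        ∫ y in (0 : ℝ)..θ, (factor μ g (a + y * Complex.I)).re := by
    filter_upwards [hpos, self_mem_nhdsWithin] with θ h1 h2
    exact integral_im_factor hg h0 hlog a b h1.le h2
  have := tendsto_nhds_unique (hzero.congr' heq) hlim
  linarith

/-- If the cut ends at `-M`, the arc integral tends to `π` as the radius increases to `M`: it is
continuous in the radius, constant beyond `M`, and tends to `π` at infinity. -/
theorem tendsto_arcIntegral_of_bounded [IsProbabilityMeasure μ] (hg : AEMeasurable g μ)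
    (h0 : ∀ᵐ ω ∂μ, 0 ≤ g ω) (hlog : Integrable (fun ω => Real.log (1 + g ω)) μ) {M : ℝ}
    (hM0 : 0 < M) (hM : ∀ᵐ ω ∂μ, g ω ≤ M)
    {S : Set Ω} (hS : MeasurableSet S) (hSpos : 0 < μ.real S) {s : ℝ} (hsM : s < M)
    (hs : ∀ᵐ ω ∂μ, ω ∈ S → g ω ≤ s) :
    Tendsto (arcIntegral μ g) (𝓝 (Real.log M)) (𝓝 Real.pi) := by
  -- Beyond the end of the cut the arc integral is constant, hence equal to its limit at infinity.
  have hconst : ∀ a, Real.log M < a → arcIntegral μ g a = Real.pi := by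
    intro a ha
    refine tendsto_nhds_unique ?_ (tendsto_arcIntegral_atTop hg h0 hlog hS hSpos hs)
    refine tendsto_const_nhds.congr' ?_
    filter_upwards [eventually_ge_atTop a] with b hb
    exact (arcIntegral_eq_of_bounded hg h0 hlog hM0 hM ha hb).symm
  have hc : 0 < (1 - s / M) / 2 := by
    have : s / M < 1 := (div_lt_one hM0).2 hsM
    linarith
  have hlim := tendsto_arcIntegral hg h0 hlog hS hSpos hc (l := 𝓝 (Real.log M))
    (f := fun y => factor μ g (Real.log M + y * Complex.I)) ?_ fun y hy =>
      (continuous_factor_line hg h0 hlog (by rw [abs_of_pos hy.1]; exact hy.2)).tendsto _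
  · have hright : Tendsto (arcIntegral μ g) (𝓝[>] (Real.log M)) (𝓝 Real.pi) := by
      refine tendsto_const_nhds.congr' ?_
      filter_upwards [self_mem_nhdsWithin] with a ha
      exact (hconst a ha).symm
    rw [tendsto_nhds_unique hright (hlim.mono_left nhdsWithin_le_nhds)]
    exact hlim
  · have ht : Tendsto (fun x => 1 - s * Real.exp (-x)) (𝓝 (Real.log M)) (𝓝 (1 - s / M)) := by
      have : Continuous fun x => 1 - s * Real.exp (-x) := by fun_prop
      convert this.tendsto (Real.log M) using 2
      rw [Real.exp_neg, Real.exp_log hM0, div_eq_mul_inv]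
    filter_upwards [ht.eventually_const_lt (show (1 - s / M) / 2 < 1 - s / M by linarith)] with x hx
    filter_upwards [hs] with ω hω hmem
    have := mul_le_mul_of_nonneg_right (hω hmem) (Real.exp_pos (-x)).le
    exact le_trans (by linarith) (le_abs_self _)

/-! ### The Poisson kernel and the Poisson integral of `log |1 - ζ² / λ²|` -/

/-- The Poisson kernel of the half-plane at height `ξ`, as a measure on `(0, ∞)`; its mass
is `1 / 2`. -/
noncomputable def poissonMeasure (ξ : ℝ) : Measure ℝ :=
  (volume.restrict (Ioi 0)).withDensity
    (fun ζ => ENNReal.ofReal (ξ / (Real.pi * (ξ ^ 2 + ζ ^ 2))))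

theorem measurable_poisson_density (ξ : ℝ) :
    Measurable (fun ζ : ℝ => ENNReal.ofReal (ξ / (Real.pi * (ξ ^ 2 + ζ ^ 2)))) := by
  fun_prop

theorem poisson_density_smul {ξ : ℝ} (hξ : 0 < ξ) (f : ℝ → ℝ) :
    (fun ζ => (ENNReal.ofReal (ξ / (Real.pi * (ξ ^ 2 + ζ ^ 2)))).toReal • f ζ) =
      fun ζ => 1 / Real.pi * (ξ * f ζ / (ξ ^ 2 + ζ ^ 2)) := by
  ext ζ
  have := Real.pi_pos
  rw [ENNReal.toReal_ofReal (by positivity), smul_eq_mul]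
  field_simp

theorem integral_poissonMeasure {ξ : ℝ} (hξ : 0 < ξ) (f : ℝ → ℝ) :
    ∫ ζ, f ζ ∂poissonMeasure ξ = 1 / Real.pi * ∫ ζ in Ioi 0, ξ * f ζ / (ξ ^ 2 + ζ ^ 2) := by
  rw [poissonMeasure, integral_withDensity_eq_integral_toReal_smul (measurable_poisson_density ξ)
    (Eventually.of_forall fun _ => ENNReal.ofReal_lt_top), poisson_density_smul hξ,
    integral_const_mul]

theorem integrable_poissonMeasure_iff {ξ : ℝ} (hξ : 0 < ξ) (f : ℝ → ℝ) :
    Integrable f (poissonMeasure ξ) ↔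
      IntegrableOn (fun ζ => ξ * f ζ / (ξ ^ 2 + ζ ^ 2)) (Ioi 0) := by
  rw [poissonMeasure, integrable_withDensity_iff_integrable_smul' (measurable_poisson_density ξ)
    (Eventually.of_forall fun _ => ENNReal.ofReal_lt_top), poisson_density_smul hξ,
    integrable_const_mul_iff (by have := Real.pi_pos; simp), IntegrableOn]

theorem poissonMeasure_absolutelyContinuous (ξ : ℝ) :
    poissonMeasure ξ ≪ volume.restrict (Ioi 0) :=
  withDensity_absolutelyContinuous _ _

theorem image_mul_tan {ξ : ℝ} (hξ : 0 < ξ) :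
    (fun φ => ξ * Real.tan φ) '' Ioo 0 (Real.pi / 2) = Ioi 0 := by
  ext ζ
  simp only [mem_image, mem_Ioo, mem_Ioi]
  constructor
  · rintro ⟨φ, hφ, rfl⟩
    exact mul_pos hξ (Real.tan_pos_of_pos_of_lt_pi_div_two hφ.1 hφ.2)
  · intro hζ
    refine ⟨Real.arctan (ζ / ξ), ⟨Real.arctan_pos.2 (div_pos hζ hξ), Real.arctan_lt_pi_div_two _⟩,
      ?_⟩
    rw [Real.tan_arctan]
    field_simp

theorem hasDerivWithinAt_mul_tan (ξ : ℝ) : ∀ φ ∈ Ioo 0 (Real.pi / 2),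
    HasDerivWithinAt (fun φ => ξ * Real.tan φ) (ξ * (1 / Real.cos φ ^ 2)) (Ioo 0 (Real.pi / 2))
      φ := by
  intro φ hφ
  have hc : 0 < Real.cos φ := Real.cos_pos_of_mem_Ioo ⟨by linarith [hφ.1, hφ.2], hφ.2⟩
  exact ((Real.hasDerivAt_tan hc.ne').const_mul ξ).hasDerivWithinAt

theorem injOn_mul_tan {ξ : ℝ} (hξ : 0 < ξ) :
    InjOn (fun φ => ξ * Real.tan φ) (Ioo 0 (Real.pi / 2)) := by
  intro a ha b hb hab
  have h : Real.tan a = Real.tan b := mul_left_cancel₀ hξ.ne' hab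
  exact Real.injOn_tan ⟨by linarith [ha.1, ha.2], ha.2⟩ ⟨by linarith [hb.1, hb.2], hb.2⟩ h

theorem abs_deriv_smul_mul_tan {ξ : ℝ} (hξ : 0 < ξ) (f : ℝ → ℝ) : ∀ φ ∈ Ioo 0 (Real.pi / 2),
    |ξ * (1 / Real.cos φ ^ 2)| • (ξ * f (ξ * Real.tan φ) / (ξ ^ 2 + (ξ * Real.tan φ) ^ 2)) =
      f (ξ * Real.tan φ) := by
  intro φ hφ
  have hc : 0 < Real.cos φ := Real.cos_pos_of_mem_Ioo ⟨by linarith [hφ.1, hφ.2], hφ.2⟩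
  have h1 : ξ ^ 2 + (ξ * Real.tan φ) ^ 2 = ξ ^ 2 * (1 / Real.cos φ ^ 2) := by
    rw [Real.tan_eq_sin_div_cos]
    field_simp
    linarith [Real.sin_sq_add_cos_sq φ]
  rw [h1, abs_of_pos (by positivity), smul_eq_mul]
  field_simp

/-- The substitution `ζ = ξ tan φ` turns the Poisson kernel into the uniform density. -/
theorem integral_poissonMeasure_tan {ξ : ℝ} (hξ : 0 < ξ) (f : ℝ → ℝ) :
    ∫ ζ, f ζ ∂poissonMeasure ξ =
      1 / Real.pi * ∫ φ in Ioo 0 (Real.pi / 2), f (ξ * Real.tan φ) := by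
  rw [integral_poissonMeasure hξ, ← image_mul_tan hξ,
    integral_image_eq_integral_abs_deriv_smul measurableSet_Ioo (hasDerivWithinAt_mul_tan ξ)
      (injOn_mul_tan hξ)]
  congr 1
  exact setIntegral_congr_fun measurableSet_Ioo (abs_deriv_smul_mul_tan hξ f)

theorem integrable_poissonMeasure_iff_tan {ξ : ℝ} (hξ : 0 < ξ) (f : ℝ → ℝ) :
    Integrable f (poissonMeasure ξ) ↔
      IntegrableOn (fun φ => f (ξ * Real.tan φ)) (Ioo 0 (Real.pi / 2)) := by
  rw [integrable_poissonMeasure_iff hξ, ← image_mul_tan hξ,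
    integrableOn_image_iff_integrableOn_abs_deriv_smul measurableSet_Ioo
      (hasDerivWithinAt_mul_tan ξ) (injOn_mul_tan hξ)]
  exact integrableOn_congr_fun (abs_deriv_smul_mul_tan hξ f) measurableSet_Ioo

theorem isFiniteMeasure_poissonMeasure {ξ : ℝ} (hξ : 0 < ξ) :
    IsFiniteMeasure (poissonMeasure ξ) := by
  have : Integrable (fun _ => (1 : ℝ)) (poissonMeasure ξ) :=
    (integrable_poissonMeasure_iff_tan hξ _).2 (integrableOn_const (by simp))
  simpa [integrable_const_iff] using this

theorem poissonMeasure_real_univ {ξ : ℝ} (hξ : 0 < ξ) :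
    (poissonMeasure ξ).real univ = 1 / 2 := by
  have := integral_poissonMeasure_tan hξ (fun _ => 1)
  rw [integral_const, smul_eq_mul, mul_one, setIntegral_const, smul_eq_mul, mul_one,
    measureReal_def volume, Real.volume_Ioo, ENNReal.toReal_ofReal (by linarith [Real.pi_pos])]
    at this
  rw [this]
  have := Real.pi_pos
  field_simp
  ring

/-- The harmonic measure of `(λ, ∞)`. -/
theorem poissonMeasure_real_Ioi {ξ lam : ℝ} (hξ : 0 < ξ) (hlam : 0 < lam) :
    Real.pi * (poissonMeasure ξ).real (Ioi lam) = Real.arctan (ξ / lam) := by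
  have h := integral_poissonMeasure_tan hξ ((Ioi lam).indicator 1)
  have hset : ∀ φ ∈ Ioo 0 (Real.pi / 2), (Ioi lam).indicator (1 : ℝ → ℝ) (ξ * Real.tan φ) =
      (Ioi (Real.arctan (lam / ξ))).indicator 1 φ := by
    intro φ hφ
    have hiff : lam < ξ * Real.tan φ ↔ Real.arctan (lam / ξ) < φ := by
      rw [← div_lt_iff₀' hξ, ← Real.arctan_lt_arctan_iff,
        Real.arctan_tan (by linarith [hφ.1, Real.pi_pos]) hφ.2]
    simp only [indicator, mem_Ioi, hiff, Pi.one_apply]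
  rw [integral_indicator_one measurableSet_Ioi, setIntegral_congr_fun measurableSet_Ioo hset,
    integral_indicator_one measurableSet_Ioi, measureReal_restrict_apply measurableSet_Ioi] at h
  have hinter : Ioi (Real.arctan (lam / ξ)) ∩ Ioo 0 (Real.pi / 2) =
      Ioo (Real.arctan (lam / ξ)) (Real.pi / 2) := by
    have : 0 < Real.arctan (lam / ξ) := Real.arctan_pos.2 (by positivity)
    ext φ
    simp only [mem_inter_iff, mem_Ioi, mem_Ioo]
    constructor
    · rintro ⟨h1, h2, h3⟩; exact ⟨h1, h3⟩
    · rintro ⟨h1, h3⟩; exact ⟨h1, this.trans h1, h3⟩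
  rw [h, hinter, measureReal_def, Real.volume_Ioo,
    ENNReal.toReal_ofReal (by linarith [Real.arctan_lt_pi_div_two (lam / ξ)]), ← inv_div lam ξ,
    Real.arctan_inv_of_pos (by positivity)]
  have := Real.pi_pos
  field_simp

theorem poissonMeasure_real_Ioi_pos {ξ : ℝ} (hξ : 0 < ξ) {lam : ℝ} (hlam : 0 < lam) :
    0 < (poissonMeasure ξ).real (Ioi lam) := by
  have h := poissonMeasure_real_Ioi hξ hlam
  have : 0 < Real.arctan (ξ / lam) := Real.arctan_pos.2 (by positivity)
  rw [← h] at this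
  exact pos_of_mul_pos_right this Real.pi_pos.le

theorem poissonMeasure_real_Iic_pos {ξ : ℝ} (hξ : 0 < ξ) {lam : ℝ} (hlam : 0 < lam) :
    0 < (poissonMeasure ξ).real (Iic lam) := by
  have := isFiniteMeasure_poissonMeasure hξ
  have h := poissonMeasure_real_Ioi hξ hlam
  have h1 := measureReal_compl (μ := poissonMeasure ξ) (measurableSet_Ioi (a := lam))
  rw [compl_Ioi, poissonMeasure_real_univ hξ] at h1
  rw [h1]
  have h2 := Real.arctan_lt_pi_div_two (ξ / lam)
  rw [← h] at h2
  have := Real.pi_pos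
  nlinarith

theorem intervalIntegrable_log_cos_add (c : ℝ) (a b : ℝ) :
    IntervalIntegrable (fun φ => Real.log (Real.cos (φ + c))) volume a b := by
  have := (intervalIntegrable_log_cos (a := a + c) (b := b + c)).comp_add_right c
  simpa using this

/-- By evenness and `π`-periodicity of `log |cos|` the two translates together cover one full
period. -/
theorem integral_log_cos_translates (c : ℝ) :
    (∫ φ in (0 : ℝ)..(Real.pi / 2), Real.log (Real.cos (φ + c))) +
      (∫ φ in (0 : ℝ)..(Real.pi / 2), Real.log (Real.cos (φ + -c))) =
      ∫ φ in (0 : ℝ)..Real.pi, Real.log (Real.cos φ) := by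
  have hper : Function.Periodic (fun φ => Real.log (Real.cos φ)) Real.pi := by
    intro φ
    simp only [Real.cos_add_pi, Real.log_neg_eq_log]
  have h2 : (∫ φ in (0 : ℝ)..(Real.pi / 2), Real.log (Real.cos (φ + -c))) =
      ∫ φ in (-(Real.pi / 2))..0, Real.log (Real.cos (φ + c)) := by
    have := intervalIntegral.integral_comp_neg (a := 0) (b := Real.pi / 2)
      (fun φ => Real.log (Real.cos (φ + c)))
    rw [neg_zero] at this
    rw [← this]
    refine intervalIntegral.integral_congr fun φ _ => ?_
    rw [← Real.cos_neg]
    ring_nf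
  rw [h2, add_comm, intervalIntegral.integral_add_adjacent_intervals
    (intervalIntegrable_log_cos_add c _ _) (intervalIntegrable_log_cos_add c _ _),
    intervalIntegral.integral_comp_add_right (fun φ => Real.log (Real.cos φ))]
  have := hper.intervalIntegral_add_eq (-(Real.pi / 2) + c) 0
  rw [zero_add] at this
  rw [← this]
  congr 1
  ring

theorem ae_ne_of_Ioo (c : ℝ) (s : Set ℝ) : ∀ᵐ φ ∂(volume.restrict s), φ ≠ c :=
  ae_restrict_of_ae (by simp [ae_iff])

/-- The identity `1 - a² tan² φ = (1 + a²) cos (φ + φ₀) cos (φ - φ₀) / cos² φ` with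
`φ₀ = arctan a`, in logarithmic form. The last bracket is written as the case `φ₀ = 0` of the first,
so that both are integrated by the same lemma. -/
theorem log_abs_one_sub_tan_sq {a : ℝ} (ha : 0 < a) :
    ∀ᵐ φ ∂(volume.restrict (Ioo 0 (Real.pi / 2))),
      Real.log |1 - (a * Real.tan φ) ^ 2| = Real.log (1 + a ^ 2) +
        (Real.log (Real.cos (φ + Real.arctan a)) + Real.log (Real.cos (φ + -Real.arctan a)))
        - (Real.log (Real.cos (φ + 0)) + Real.log (Real.cos (φ + -0))) := by
  filter_upwards [ae_restrict_mem measurableSet_Ioo, ae_ne_of_Ioo (Real.arctan a⁻¹) _]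
    with φ hφ hne
  have hc : 0 < Real.cos φ := Real.cos_pos_of_mem_Ioo ⟨by linarith [hφ.1, hφ.2], hφ.2⟩
  have htan : 0 < Real.tan φ := Real.tan_pos_of_pos_of_lt_pi_div_two hφ.1 hφ.2
  have hca : Real.cos (Real.arctan a) ^ 2 = 1 / (1 + a ^ 2) := Real.cos_sq_arctan a
  have hsa : Real.sin (Real.arctan a) ^ 2 = a ^ 2 / (1 + a ^ 2) := by
    rw [Real.sin_sq, hca]; field_simp; ring
  have hprod : Real.cos (φ + Real.arctan a) * Real.cos (φ + -Real.arctan a) =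
      (1 - (a * Real.tan φ) ^ 2) * Real.cos φ ^ 2 / (1 + a ^ 2) := by
    rw [Real.cos_add, Real.cos_add, Real.cos_neg, Real.sin_neg, Real.tan_eq_sin_div_cos]
    have : (Real.cos φ * Real.cos (Real.arctan a) - Real.sin φ * Real.sin (Real.arctan a)) *
        (Real.cos φ * Real.cos (Real.arctan a) - Real.sin φ * -Real.sin (Real.arctan a)) =
        Real.cos φ ^ 2 * Real.cos (Real.arctan a) ^ 2 -
          Real.sin φ ^ 2 * Real.sin (Real.arctan a) ^ 2 := by ring
    rw [this, hca, hsa]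
    field_simp
  have hne1 : 1 - (a * Real.tan φ) ^ 2 ≠ 0 := by
    intro h
    have h1 : a * Real.tan φ = 1 := by
      have : 0 < a * Real.tan φ := by positivity
      nlinarith
    apply hne
    rw [← eq_inv_of_mul_eq_one_right h1,
      Real.arctan_tan (by linarith [hφ.1, Real.pi_pos]) hφ.2]
  have hpos : 0 < 1 + a ^ 2 := by positivity
  have hne2 : Real.cos (φ + Real.arctan a) * Real.cos (φ + -Real.arctan a) ≠ 0 := by
    rw [hprod]; positivity
  rw [← Real.log_mul (left_ne_zero_of_mul hne2) (right_ne_zero_of_mul hne2), hprod, add_zero,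
    neg_zero, add_zero, Real.log_abs, Real.log_div (by positivity) hpos.ne',
    Real.log_mul hne1 (by positivity), Real.log_pow]
  push_cast
  ring

theorem intervalIntegrable_log_cos_pair (c : ℝ) :
    IntervalIntegrable (fun φ => Real.log (Real.cos (φ + c)) + Real.log (Real.cos (φ + -c)))
      volume 0 (Real.pi / 2) :=
  (intervalIntegrable_log_cos_add c _ _).add (intervalIntegrable_log_cos_add (-c) _ _)

theorem log_abs_one_sub_sq_div_comp_tan {ξ lam : ℝ} (φ : ℝ) :
    Real.log |1 - (ξ * Real.tan φ) ^ 2 / lam ^ 2| =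
      Real.log |1 - (ξ / lam * Real.tan φ) ^ 2| := by
  congr 2
  rw [← div_pow, mul_div_right_comm]

theorem integrable_log_abs_one_sub_sq_div {ξ lam : ℝ} (hξ : 0 < ξ) (hlam : 0 < lam) :
    Integrable (fun ζ => Real.log |1 - ζ ^ 2 / lam ^ 2|) (poissonMeasure ξ) := by
  rw [integrable_poissonMeasure_iff_tan hξ, IntegrableOn]
  simp only [log_abs_one_sub_sq_div_comp_tan]
  refine Integrable.congr ?_ (EventuallyEq.symm (log_abs_one_sub_tan_sq (div_pos hξ hlam)))
  have h := ((intervalIntegrable_const (c := Real.log (1 + (ξ / lam) ^ 2))).add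
    (intervalIntegrable_log_cos_pair (Real.arctan (ξ / lam)))).sub
      (intervalIntegrable_log_cos_pair 0)
  have hpi : (0 : ℝ) ≤ Real.pi / 2 := by linarith [Real.pi_pos]
  exact (intervalIntegrable_iff_integrableOn_Ioo_of_le hpi).1 h

/-- The Poisson integral of `log |1 - ζ² / λ²|`. -/
theorem integral_log_abs_one_sub_sq_div {ξ lam : ℝ} (hξ : 0 < ξ) (hlam : 0 < lam) :
    ∫ ζ, Real.log |1 - ζ ^ 2 / lam ^ 2| ∂poissonMeasure ξ =
      Real.log (1 + (ξ / lam) ^ 2) / 2 := by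
  have hpi : (0 : ℝ) ≤ Real.pi / 2 := by linarith [Real.pi_pos]
  rw [integral_poissonMeasure_tan hξ]
  simp only [log_abs_one_sub_sq_div_comp_tan]
  rw [integral_congr_ae (log_abs_one_sub_tan_sq (div_pos hξ hlam)),
    ← integral_Ioc_eq_integral_Ioo, ← intervalIntegral.integral_of_le hpi,
    intervalIntegral.integral_sub (intervalIntegrable_const.add
      (intervalIntegrable_log_cos_pair _)) (intervalIntegrable_log_cos_pair 0),
    intervalIntegral.integral_add intervalIntegrable_const (intervalIntegrable_log_cos_pair _),
    intervalIntegral.integral_add (intervalIntegrable_log_cos_add _ _ _)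
      (intervalIntegrable_log_cos_add _ _ _),
    intervalIntegral.integral_add (intervalIntegrable_log_cos_add _ _ _)
      (intervalIntegrable_log_cos_add _ _ _),
    integral_log_cos_translates, integral_log_cos_translates, intervalIntegral.integral_const]
  have := Real.pi_pos
  rw [smul_eq_mul]
  field_simp
  ring

theorem integrable_log_one_add_sq {ξ : ℝ} (hξ : 0 < ξ) :
    Integrable (fun ζ => Real.log (1 + ζ ^ 2)) (poissonMeasure ξ) := by
  rw [integrable_poissonMeasure_iff_tan hξ, IntegrableOn]
  have hpi : (0 : ℝ) ≤ Real.pi / 2 := by linarith [Real.pi_pos]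
  have h := (intervalIntegrable_const (c := Real.log (1 + ξ ^ 2))).sub
      (intervalIntegrable_log_cos_pair 0)
  have h' := (intervalIntegrable_iff_integrableOn_Ioo_of_le hpi).1 h
  refine Integrable.mono' h' ?_ ?_
  · have : Measurable Real.tan := by
      simp only [funext Real.tan_eq_sin_div_cos]
      fun_prop
    exact (by fun_prop :
      Measurable fun φ => Real.log (1 + (ξ * Real.tan φ) ^ 2)).aestronglyMeasurable
  · filter_upwards [ae_restrict_mem measurableSet_Ioo] with φ hφ
    have hc : 0 < Real.cos φ := Real.cos_pos_of_mem_Ioo ⟨by linarith [hφ.1, hφ.2], hφ.2⟩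
    have h1 : (Real.cos φ ^ 2)⁻¹ = 1 + Real.tan φ ^ 2 := by
      rw [← Real.inv_one_add_tan_sq hc.ne', inv_inv]
    rw [Real.norm_of_nonneg (Real.log_nonneg (by nlinarith [sq_nonneg (ξ * Real.tan φ)]))]
    simp only [add_zero, neg_zero]
    have h2 : Real.log (1 + ξ ^ 2) - (Real.log (Real.cos φ) + Real.log (Real.cos φ)) =
        Real.log ((1 + ξ ^ 2) * (1 + Real.tan φ ^ 2)) := by
      rw [← h1, Real.log_mul (by positivity) (by positivity), Real.log_inv, Real.log_pow]
      push_cast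
      ring
    rw [h2]
    exact Real.log_le_log (by positivity) (by nlinarith [sq_nonneg (Real.tan φ), sq_nonneg ξ])

/-! ### Bounds for `ψ_λ` and its transform -/

theorem ae_poissonMeasure_pos (ξ : ℝ) : ∀ᵐ ζ ∂poissonMeasure ξ, 0 < ζ :=
  (poissonMeasure_absolutelyContinuous ξ).ae_le (ae_restrict_mem measurableSet_Ioi)

theorem ae_poissonMeasure_ne (ξ c : ℝ) : ∀ᵐ ζ ∂poissonMeasure ξ, ζ ≠ c :=
  (poissonMeasure_absolutelyContinuous ξ).ae_le (ae_ne_of_Ioo c _)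

theorem dagger_eq (f : ℝ → ℝ) {ξ : ℝ} (hξ : 0 < ξ) :
    dagger f ξ = Real.exp (∫ ζ, Real.log (f (ζ ^ 2)) ∂poissonMeasure ξ) := by
  rw [integral_poissonMeasure hξ]
  rfl

/-- The hypotheses on `ψ`: a positive `C¹` function on `(0, ∞)` with positive derivative, such that
`log (1 + ψ(ζ²)) / ζ²` is integrable. -/
structure Admissible (ψ : ℝ → ℝ) : Prop where
  pos : ∀ x : ℝ, 0 < x → 0 < ψ x
  contDiffOn : ContDiffOn ℝ 1 ψ (Ioi (0 : ℝ))
  deriv_pos : ∀ x : ℝ, 0 < x → 0 < deriv ψ x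
  integrable : IntegrableOn (fun ζ : ℝ => Real.log (1 + ψ (ζ ^ 2)) / ζ ^ 2) (Ioi (0 : ℝ)) volume

namespace Admissible

variable {ψ : ℝ → ℝ}

theorem continuousOn_deriv (h : Admissible ψ) : ContinuousOn (deriv ψ) (Ioi 0) :=
  h.contDiffOn.continuousOn_deriv_of_isOpen isOpen_Ioi le_rfl

theorem hasDerivAt (h : Admissible ψ) {x : ℝ} (hx : 0 < x) : HasDerivAt ψ (deriv ψ x) x :=
  (differentiableAt_of_deriv_ne_zero (h.deriv_pos x hx).ne').hasDerivAt

theorem strictMonoOn (h : Admissible ψ) : StrictMonoOn ψ (Ioi 0) := by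
  refine strictMonoOn_of_deriv_pos (convex_Ioi 0) h.contDiffOn.continuousOn fun x hx => ?_
  rw [interior_Ioi] at hx
  exact h.deriv_pos x hx

theorem lt (h : Admissible ψ) {x y : ℝ} (hx : 0 < x) (hxy : x < y) : ψ x < ψ y :=
  h.strictMonoOn hx (hx.trans hxy) hxy

theorem le (h : Admissible ψ) {x y : ℝ} (hx : 0 < x) (hxy : x ≤ y) : ψ x ≤ ψ y :=
  h.strictMonoOn.monotoneOn hx (hx.trans_le hxy) hxy

theorem exists_sub_eq (h : Admissible ψ) {x y : ℝ} (hx : 0 < x) (hxy : x < y) :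
    ∃ η ∈ Icc x y, ψ y - ψ x = deriv ψ η * (y - x) := by
  have hpos : ∀ z, x ≤ z → 0 < z := fun z hz => hx.trans_le hz
  obtain ⟨η, hη, hs⟩ := exists_deriv_eq_slope ψ hxy
    (h.contDiffOn.continuousOn.mono fun z hz => hpos z hz.1)
    (fun z hz => (h.hasDerivAt (hpos z hz.1.le)).differentiableAt.differentiableWithinAt)
  refine ⟨η, Ioo_subset_Icc_self hη, ?_⟩
  rw [hs, div_mul_cancel₀ _ (sub_pos.2 hxy).ne']

/-- `ψ_λ` as the reciprocal of a derivative, by the mean value theorem. -/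
theorem exists_psiLambda_eq (h : Admissible ψ) {lam ξ : ℝ} (hlam : 0 < lam) (hξ : 0 < ξ) :
    ∃ η ∈ uIcc ξ (lam ^ 2), psiLambda ψ lam ξ = ψ (lam ^ 2) / (lam ^ 2 * deriv ψ η) := by
  have hl2 : 0 < lam ^ 2 := by positivity
  have hψ := h.pos _ hl2
  rcases lt_trichotomy ξ (lam ^ 2) with hlt | heq | hgt
  · obtain ⟨η, hη, hs⟩ := h.exists_sub_eq hξ hlt
    refine ⟨η, by rwa [uIcc_of_le hlt.le], ?_⟩
    have hd := h.deriv_pos η (hξ.trans_le hη.1)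
    have hx : lam ^ 2 - ξ ≠ 0 := (sub_pos.2 hlt).ne'
    rw [psiLambda, if_neg hlt.ne, one_sub_div hl2.ne', one_sub_div hψ.ne', hs]
    field_simp
  · refine ⟨ξ, left_mem_uIcc, ?_⟩
    rw [psiLambda, if_pos heq, heq]
  · obtain ⟨η, hη, hs⟩ := h.exists_sub_eq hl2 hgt
    refine ⟨η, by rwa [uIcc_of_ge hgt.le], ?_⟩
    have hd := h.deriv_pos η (hl2.trans_le hη.1)
    have hx : lam ^ 2 - ξ ≠ 0 := (sub_neg.2 hgt).ne
    have hs' : ψ (lam ^ 2) - ψ ξ = deriv ψ η * (lam ^ 2 - ξ) := by linarith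
    rw [psiLambda, if_neg hgt.ne', one_sub_div hl2.ne', one_sub_div hψ.ne', hs']
    field_simp

theorem psiLambda_pos (h : Admissible ψ) {lam ξ : ℝ} (hlam : 0 < lam) (hξ : 0 < ξ) :
    0 < psiLambda ψ lam ξ := by
  have hl2 : 0 < lam ^ 2 := by positivity
  obtain ⟨η, hη, hs⟩ := h.exists_psiLambda_eq hlam hξ
  have hη0 : 0 < η := (lt_min hξ hl2).trans_le hη.1
  rw [hs]
  exact div_pos (h.pos _ hl2) (mul_pos hl2 (h.deriv_pos _ hη0))

/-- Bounds for `ψ_λ`, uniform for `λ` in a compact subinterval of `(0, ∞)`. -/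
theorem exists_psiLambda_bounds (h : Admissible ψ) {α β : ℝ} (hα : 0 < α) (hαβ : α ≤ β) :
    ∃ c C : ℝ, 0 < c ∧ 0 < C ∧ ∀ lam ∈ Icc α β, ∀ ξ : ℝ, 0 < ξ →
      c / (1 + ψ ξ) ≤ psiLambda ψ lam ξ ∧ psiLambda ψ lam ξ ≤ C * (1 + ξ) := by
  have hβ : 0 < β := hα.trans_le hαβ
  have hα2 : 0 < α ^ 2 := by positivity
  have hβ2 : 0 < β ^ 2 := by positivity
  have hA : 0 < α ^ 2 / 2 := by positivity
  have hαβ2 : α ^ 2 ≤ β ^ 2 := by gcongr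
  have hsub : Icc (α ^ 2 / 2) (2 * β ^ 2) ⊆ Ioi 0 := fun x hx => hA.trans_le hx.1
  have hne : (Icc (α ^ 2 / 2) (2 * β ^ 2)).Nonempty := nonempty_Icc.2 (by linarith)
  obtain ⟨x₀, hx₀, hmin⟩ := isCompact_Icc.exists_isMinOn hne (h.continuousOn_deriv.mono hsub)
  obtain ⟨x₁, hx₁, hmax⟩ := isCompact_Icc.exists_isMaxOn hne (h.continuousOn_deriv.mono hsub)
  have hm := h.deriv_pos x₀ (hsub hx₀)
  have hK := h.deriv_pos x₁ (hsub hx₁)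
  have hψα := h.pos _ hα2
  have hψβ := h.pos _ hβ2
  have hlow : 0 < 1 - ψ (α ^ 2 / 2) / ψ (α ^ 2) := by
    rw [sub_pos, div_lt_one hψα]
    exact h.lt hA (by linarith)
  have hhigh : 0 < ψ (2 * β ^ 2) / ψ (β ^ 2) - 1 := by
    rw [sub_pos, one_lt_div hψβ]
    exact h.lt hβ2 (by linarith)
  -- One constant for each of `ξ` close to `λ²`, `ξ < α² / 2` and `ξ > 2 β²`.
  set C₁ := ψ (β ^ 2) / (α ^ 2 * deriv ψ x₀) with hC₁
  set C₂ := (1 - ψ (α ^ 2 / 2) / ψ (α ^ 2))⁻¹ with hC₂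
  set C₃ := (α ^ 2 * (ψ (2 * β ^ 2) / ψ (β ^ 2) - 1))⁻¹ with hC₃
  set c₁ := ψ (α ^ 2) / (β ^ 2 * deriv ψ x₁) with hc₁
  have h1 : 0 < C₁ := by positivity
  have h2 : 0 < C₂ := inv_pos.2 hlow
  have h3 : 0 < C₃ := inv_pos.2 (mul_pos hα2 hhigh)
  have h4 : 0 < c₁ := by positivity
  refine ⟨min c₁ (min (1 / 2) (ψ (α ^ 2))), C₁ + C₂ + C₃,
    lt_min h4 (lt_min (by norm_num) hψα), by positivity, ?_⟩
  intro lam hlam ξ hξ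
  have hl0 : 0 < lam := hα.trans_le hlam.1
  have hl2 : 0 < lam ^ 2 := by positivity
  have hl1 : α ^ 2 ≤ lam ^ 2 := by have := hlam.1; gcongr
  have hl3 : lam ^ 2 ≤ β ^ 2 := by have := hlam.2; gcongr
  have hψξ := h.pos ξ hξ
  have hψl := h.pos _ hl2
  have hψ1 : ψ (α ^ 2) ≤ ψ (lam ^ 2) := h.le hα2 hl1
  have hψ3 : ψ (lam ^ 2) ≤ ψ (β ^ 2) := h.le hl2 hl3
  have hcle : ∀ k, min c₁ (min (1 / 2) (ψ (α ^ 2))) ≤ k →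
      min c₁ (min (1 / 2) (ψ (α ^ 2))) / (1 + ψ ξ) ≤ k := fun k hk =>
    (div_le_self (le_min h4.le (le_min (by norm_num) hψα.le)) (by linarith)).trans hk
  have hm1 := min_le_left c₁ (min (1 / 2) (ψ (α ^ 2)))
  have hm2 := (min_le_right c₁ (min (1 / 2) (ψ (α ^ 2)))).trans (min_le_left _ _)
  have hm3 := (min_le_right c₁ (min (1 / 2) (ψ (α ^ 2)))).trans (min_le_right _ _)
  have hsum : ∀ k, k ≤ C₁ + C₂ + C₃ → k ≤ (C₁ + C₂ + C₃) * (1 + ξ) := fun k hk => by nlinarith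
  rcases lt_or_ge ξ (α ^ 2 / 2) with hξA | hξA
  · have hne : ξ ≠ lam ^ 2 := by intro h; linarith
    rw [psiLambda, if_neg hne]
    have n1 : 1 / 2 ≤ 1 - ξ / lam ^ 2 := by
      have : ξ / lam ^ 2 ≤ 1 / 2 := by rw [div_le_iff₀ hl2]; linarith
      linarith
    have n2 : 1 - ξ / lam ^ 2 ≤ 1 := by
      have : 0 ≤ ξ / lam ^ 2 := by positivity
      linarith
    have d1 : 1 - ψ (α ^ 2 / 2) / ψ (α ^ 2) ≤ 1 - ψ ξ / ψ (lam ^ 2) := by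
      have : ψ ξ ≤ ψ (α ^ 2 / 2) := h.le hξ hξA.le
      have hψA := h.pos _ hA
      have : ψ ξ / ψ (lam ^ 2) ≤ ψ (α ^ 2 / 2) / ψ (α ^ 2) := by gcongr
      linarith
    have d2 : 1 - ψ ξ / ψ (lam ^ 2) ≤ 1 := by
      have : 0 ≤ ψ ξ / ψ (lam ^ 2) := by positivity
      linarith
    have d0 := hlow.trans_le d1
    constructor
    · refine hcle _ (hm2.trans ?_)
      rw [le_div_iff₀ d0]
      linarith
    · refine hsum _ (le_trans ?_ (by linarith : C₂ ≤ C₁ + C₂ + C₃))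
      rw [hC₂, ← one_div]
      gcongr
  rcases le_or_gt ξ (2 * β ^ 2) with hξB | hξB
  · obtain ⟨η, hη, hs⟩ := h.exists_psiLambda_eq hl0 hξ
    have hη' : η ∈ Icc (α ^ 2 / 2) (2 * β ^ 2) :=
      ⟨(le_min hξA (by linarith)).trans hη.1, hη.2.trans (max_le hξB (by linarith))⟩
    have e1 : deriv ψ x₀ ≤ deriv ψ η := hmin hη'
    have e2 : deriv ψ η ≤ deriv ψ x₁ := hmax hη'
    have e0 := hm.trans_le e1
    rw [hs]
    constructor
    · refine hcle _ (hm1.trans ?_)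
      rw [hc₁]
      gcongr
    · refine hsum _ (le_trans ?_ (by linarith : C₁ ≤ C₁ + C₂ + C₃))
      rw [hC₁]
      gcongr
  · have hne : ξ ≠ lam ^ 2 := by intro h; linarith
    rw [psiLambda, if_neg hne, ← neg_div_neg_eq (1 - ξ / lam ^ 2), neg_sub, neg_sub]
    have n1 : 1 ≤ ξ / lam ^ 2 - 1 := by
      have : 2 ≤ ξ / lam ^ 2 := by rw [le_div_iff₀ hl2]; linarith
      linarith
    have n2 : ξ / lam ^ 2 - 1 ≤ ξ / α ^ 2 := by
      have : ξ / lam ^ 2 ≤ ξ / α ^ 2 := by gcongr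
      linarith
    have d1 : ψ (2 * β ^ 2) / ψ (β ^ 2) - 1 ≤ ψ ξ / ψ (lam ^ 2) - 1 := by
      have : ψ (2 * β ^ 2) ≤ ψ ξ := h.le (by positivity) hξB.le
      have : ψ (2 * β ^ 2) / ψ (β ^ 2) ≤ ψ ξ / ψ (lam ^ 2) := by gcongr
      linarith
    have d2 : ψ ξ / ψ (lam ^ 2) - 1 ≤ (1 + ψ ξ) / ψ (α ^ 2) := by
      have : ψ ξ / ψ (lam ^ 2) ≤ (1 + ψ ξ) / ψ (α ^ 2) := by gcongr; linarith
      linarith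
    have d0 := hhigh.trans_le d1
    constructor
    · calc min c₁ (min (1 / 2) (ψ (α ^ 2))) / (1 + ψ ξ) ≤ ψ (α ^ 2) / (1 + ψ ξ) := by gcongr
        _ = 1 / ((1 + ψ ξ) / ψ (α ^ 2)) := by rw [one_div_div]
        _ ≤ _ := by gcongr
    · calc (ξ / lam ^ 2 - 1) / (ψ ξ / ψ (lam ^ 2) - 1)
          ≤ (ξ / α ^ 2) / (ψ (2 * β ^ 2) / ψ (β ^ 2) - 1) := by gcongr
        _ = C₃ * ξ := by rw [hC₃]; field_simp
        _ ≤ (C₁ + C₂ + C₃) * (1 + ξ) := by nlinarith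

theorem exists_abs_log_psiLambda_le (h : Admissible ψ) {α β : ℝ} (hα : 0 < α) (hαβ : α ≤ β) :
    ∃ D : ℝ, ∀ lam ∈ Icc α β, ∀ ξ : ℝ, 0 < ξ →
      |Real.log (psiLambda ψ lam ξ)| ≤ D + Real.log (1 + ξ) + Real.log (1 + ψ ξ) := by
  obtain ⟨c, C, hc, hC, hb⟩ := h.exists_psiLambda_bounds hα hαβ
  refine ⟨|Real.log c| + |Real.log C|, fun lam hlam ξ hξ => ?_⟩
  obtain ⟨h1, h2⟩ := hb lam hlam ξ hξ
  have hψ := h.pos ξ hξ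
  have h3 := Real.log_le_log (by positivity) h1
  have h4 := Real.log_le_log (h.psiLambda_pos (hα.trans_le hlam.1) hξ) h2
  rw [Real.log_div hc.ne' (by positivity)] at h3
  rw [Real.log_mul hC.ne' (by positivity)] at h4
  have h5 : 0 ≤ Real.log (1 + ξ) := Real.log_nonneg (by linarith)
  have h6 : 0 ≤ Real.log (1 + ψ ξ) := Real.log_nonneg (by linarith)
  have h7 := le_abs_self (Real.log C)
  have h8 := neg_abs_le (Real.log c)
  have h9 := abs_nonneg (Real.log C)
  have h10 := abs_nonneg (Real.log c)
  rw [abs_le]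
  constructor <;> linarith

theorem aemeasurable_comp_sq (h : Admissible ψ) (ξ : ℝ) :
    AEMeasurable (fun ζ => ψ (ζ ^ 2)) (poissonMeasure ξ) := by
  have : ContinuousOn (fun ζ : ℝ => ψ (ζ ^ 2)) (Ioi 0) :=
    h.contDiffOn.continuousOn.comp (by fun_prop) fun ζ hζ => mem_Ioi.2 (pow_pos (mem_Ioi.1 hζ) 2)
  exact (this.aemeasurable measurableSet_Ioi).mono_ac (poissonMeasure_absolutelyContinuous ξ)

theorem integrable_log_one_add (h : Admissible ψ) {ξ : ℝ} (hξ : 0 < ξ) :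
    Integrable (fun ζ => Real.log (1 + ψ (ζ ^ 2))) (poissonMeasure ξ) := by
  rw [integrable_poissonMeasure_iff hξ]
  have hc : ContinuousOn (fun ζ : ℝ => ψ (ζ ^ 2)) (Ioi 0) :=
    h.contDiffOn.continuousOn.comp (by fun_prop) fun ζ hζ => mem_Ioi.2 (pow_pos (mem_Ioi.1 hζ) 2)
  have hm := hc.aemeasurable (μ := volume) measurableSet_Ioi
  refine Integrable.mono' (h.integrable.const_mul ξ) ?_ ?_
  · exact (((Real.measurable_log.comp_aemeasurable (hm.const_add 1)).const_mul ξ).div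
      (by fun_prop)).aestronglyMeasurable
  · filter_upwards [ae_restrict_mem measurableSet_Ioi] with ζ hζ
    have hζ' : 0 < ζ := hζ
    have hψ := h.pos (ζ ^ 2) (by positivity)
    have hl : 0 ≤ Real.log (1 + ψ (ζ ^ 2)) := Real.log_nonneg (by linarith)
    rw [Real.norm_of_nonneg (by positivity), mul_div_assoc]
    gcongr
    nlinarith

theorem log_psiLambda_eq (h : Admissible ψ) {lam ζ : ℝ} (hlam : 0 < lam) (hζ : 0 < ζ)
    (hne : ζ ≠ lam) : Real.log (psiLambda ψ lam (ζ ^ 2)) =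
      Real.log |1 - ζ ^ 2 / lam ^ 2| - Real.log |1 - ψ (ζ ^ 2) / ψ (lam ^ 2)| := by
  have hl2 : 0 < lam ^ 2 := by positivity
  have hne2 : ζ ^ 2 ≠ lam ^ 2 := fun h => hne (by
    rwa [sq_eq_sq₀ hζ.le hlam.le] at h)
  have hp := h.psiLambda_pos hlam (ξ := ζ ^ 2) (by positivity)
  rw [psiLambda, if_neg hne2] at hp ⊢
  obtain ⟨h1, h2⟩ := div_ne_zero_iff.1 hp.ne'
  rw [Real.log_div h1 h2, Real.log_abs, Real.log_abs]

theorem integrable_log_psiLambda (h : Admissible ψ) {lam ξ : ℝ} (hlam : 0 < lam) (hξ : 0 < ξ) :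
    Integrable (fun ζ => Real.log (psiLambda ψ lam (ζ ^ 2))) (poissonMeasure ξ) := by
  have := isFiniteMeasure_poissonMeasure hξ
  obtain ⟨D, hD⟩ := h.exists_abs_log_psiLambda_le hlam le_rfl
  refine Integrable.mono' (((integrable_const D).add (integrable_log_one_add_sq hξ)).add
    (h.integrable_log_one_add hξ)) ?_ ?_
  · refine AEStronglyMeasurable.congr (f := fun ζ => Real.log |1 - ζ ^ 2 / lam ^ 2| -
      Real.log |1 - ψ (ζ ^ 2) / ψ (lam ^ 2)|) ?_ ?_
    · have hm := h.aemeasurable_comp_sq ξ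
      refine AEStronglyMeasurable.sub ?_ ?_
      · exact (by fun_prop : Measurable fun ζ : ℝ =>
          Real.log |1 - ζ ^ 2 / lam ^ 2|).aestronglyMeasurable
      · exact (Real.measurable_log.comp_aemeasurable (continuous_abs.measurable.comp_aemeasurable
          ((hm.div_const _).const_sub 1))).aestronglyMeasurable
    · filter_upwards [ae_poissonMeasure_pos ξ, ae_poissonMeasure_ne ξ lam] with ζ hζ hne
      exact (h.log_psiLambda_eq hlam hζ hne).symm
  · filter_upwards [ae_poissonMeasure_pos ξ] with ζ hζ
    exact hD lam (by simp) (ζ ^ 2) (by positivity)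

theorem integrableOn_daggerIntegrand (h : Admissible ψ) {lam ξ : ℝ} (hlam : 0 < lam)
    (hξ : 0 < ξ) : IntegrableOn (fun ζ => daggerIntegrand (psiLambda ψ lam) ξ ζ) (Ioi 0) :=
  (integrable_poissonMeasure_iff hξ _).1 (h.integrable_log_psiLambda hlam hξ)

/-- The transforms `ψ_λ^†(ξ)` are bounded for `λ` in a compact subinterval of `(0, ∞)`. -/
theorem exists_dagger_le (h : Admissible ψ) {α β ξ : ℝ} (hα : 0 < α) (hαβ : α ≤ β)
    (hξ : 0 < ξ) : ∃ B : ℝ, ∀ lam ∈ Icc α β, dagger (psiLambda ψ lam) ξ ≤ B := by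
  have := isFiniteMeasure_poissonMeasure hξ
  obtain ⟨D, hD⟩ := h.exists_abs_log_psiLambda_le hα hαβ
  refine ⟨Real.exp (∫ ζ, (D + Real.log (1 + ζ ^ 2) + Real.log (1 + ψ (ζ ^ 2)))
    ∂poissonMeasure ξ), fun lam hlam => ?_⟩
  rw [dagger_eq _ hξ, Real.exp_le_exp]
  refine integral_mono_ae (h.integrable_log_psiLambda (hα.trans_le hlam.1) hξ)
    (((integrable_const D).add (integrable_log_one_add_sq hξ)).add
    (h.integrable_log_one_add hξ)) ?_
  filter_upwards [ae_poissonMeasure_pos ξ] with ζ hζ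
  exact (le_abs_self _).trans (hD lam hlam (ζ ^ 2) (by positivity))

theorem log_abs_one_sub_ae_eq (h : Admissible ψ) {lam : ℝ} (hlam : 0 < lam) (ξ : ℝ) :
    (fun ζ => Real.log |1 - ψ (ζ ^ 2) / ψ (lam ^ 2)|) =ᵐ[poissonMeasure ξ]
      fun ζ => Real.log |1 - ζ ^ 2 / lam ^ 2| - Real.log (psiLambda ψ lam (ζ ^ 2)) := by
  filter_upwards [ae_poissonMeasure_pos ξ, ae_poissonMeasure_ne ξ lam] with ζ hζ hne
  rw [h.log_psiLambda_eq hlam hζ hne]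
  ring

theorem integrable_log_abs_one_sub (h : Admissible ψ) {lam ξ : ℝ} (hlam : 0 < lam)
    (hξ : 0 < ξ) :
    Integrable (fun ζ => Real.log |1 - ψ (ζ ^ 2) / ψ (lam ^ 2)|) (poissonMeasure ξ) :=
  ((integrable_log_abs_one_sub_sq_div hξ hlam).sub
    (h.integrable_log_psiLambda hlam hξ)).congr (h.log_abs_one_sub_ae_eq hlam ξ).symm

/-- The transform `ψ_λ^†(ξ)` as the modulus of a boundary value. -/
theorem exp_neg_integral_log_abs_one_sub (h : Admissible ψ) {lam ξ : ℝ} (hlam : 0 < lam)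
    (hξ : 0 < ξ) :
    Real.exp (-∫ ζ, Real.log |1 - ψ (ζ ^ 2) / ψ (lam ^ 2)| ∂poissonMeasure ξ) =
      dagger (psiLambda ψ lam) ξ / √(1 + (ξ / lam) ^ 2) := by
  rw [integral_congr_ae (h.log_abs_one_sub_ae_eq hlam ξ),
    integral_sub (integrable_log_abs_one_sub_sq_div hξ hlam) (h.integrable_log_psiLambda hlam hξ),
    integral_log_abs_one_sub_sq_div hξ hlam, neg_sub, Real.exp_sub, ← dagger_eq _ hξ,
    ← Real.log_sqrt (by positivity), Real.exp_log (by positivity)]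

end Admissible

/-! ### The integral identity -/

/-- The probability measure on `(0, ∞)` whose factor is the product of the Wiener–Hopf factors at
`ξ₁` and `ξ₂`. -/
noncomputable def poissonSum (ξ₁ ξ₂ : ℝ) : Measure ℝ := poissonMeasure ξ₁ + poissonMeasure ξ₂

theorem isProbabilityMeasure_poissonSum {ξ₁ ξ₂ : ℝ} (h₁ : 0 < ξ₁) (h₂ : 0 < ξ₂) :
    IsProbabilityMeasure (poissonSum ξ₁ ξ₂) := by
  have i₁ := isFiniteMeasure_poissonMeasure h₁
  have i₂ := isFiniteMeasure_poissonMeasure h₂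
  have h : (poissonSum ξ₁ ξ₂).real univ = 1 := by
    rw [poissonSum, measureReal_add_apply, poissonMeasure_real_univ h₁,
      poissonMeasure_real_univ h₂]
    norm_num
  exact ⟨by rwa [measureReal_def, ENNReal.toReal_eq_one_iff] at h⟩

theorem poissonSum_real_Ioi {ξ₁ ξ₂ lam : ℝ} (h₁ : 0 < ξ₁) (h₂ : 0 < ξ₂) (hlam : 0 < lam) :
    Real.pi * (poissonSum ξ₁ ξ₂).real (Ioi lam) =
      Real.arctan (ξ₁ / lam) + Real.arctan (ξ₂ / lam) := by
  have i₁ := isFiniteMeasure_poissonMeasure h₁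
  have i₂ := isFiniteMeasure_poissonMeasure h₂
  rw [poissonSum, measureReal_add_apply, mul_add, poissonMeasure_real_Ioi h₁ hlam,
    poissonMeasure_real_Ioi h₂ hlam]

theorem poissonSum_real_Ioi_pos {ξ₁ ξ₂ lam : ℝ} (h₁ : 0 < ξ₁) (h₂ : 0 < ξ₂) (hlam : 0 < lam) :
    0 < (poissonSum ξ₁ ξ₂).real (Ioi lam) := by
  have i₁ := isFiniteMeasure_poissonMeasure h₁
  have i₂ := isFiniteMeasure_poissonMeasure h₂
  rw [poissonSum, measureReal_add_apply]
  exact add_pos (poissonMeasure_real_Ioi_pos h₁ hlam) (poissonMeasure_real_Ioi_pos h₂ hlam)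

theorem poissonSum_real_Iic_pos {ξ₁ ξ₂ lam : ℝ} (h₁ : 0 < ξ₁) (h₂ : 0 < ξ₂) (hlam : 0 < lam) :
    0 < (poissonSum ξ₁ ξ₂).real (Iic lam) := by
  have i₁ := isFiniteMeasure_poissonMeasure h₁
  have i₂ := isFiniteMeasure_poissonMeasure h₂
  rw [poissonSum, measureReal_add_apply]
  exact add_pos (poissonMeasure_real_Iic_pos h₁ hlam) (poissonMeasure_real_Iic_pos h₂ hlam)

theorem ae_poissonSum_pos (ξ₁ ξ₂ : ℝ) : ∀ᵐ ζ ∂poissonSum ξ₁ ξ₂, 0 < ζ :=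
  ae_add_measure_iff.2 ⟨ae_poissonMeasure_pos ξ₁, ae_poissonMeasure_pos ξ₂⟩

theorem ae_poissonSum_ne (ξ₁ ξ₂ c : ℝ) : ∀ᵐ ζ ∂poissonSum ξ₁ ξ₂, ζ ≠ c :=
  ae_add_measure_iff.2 ⟨ae_poissonMeasure_ne ξ₁ c, ae_poissonMeasure_ne ξ₂ c⟩

/-- The product of the boundary values of two elementary factors has imaginary part
`(t₁ + t₂) / ((1 + t₁²) (1 + t₂²))`. -/
theorem sin_arctan_add_arctan_div (t₁ t₂ : ℝ) :
    Real.sin (Real.arctan t₁ + Real.arctan t₂) / (√(1 + t₁ ^ 2) * √(1 + t₂ ^ 2)) =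
      (t₁ + t₂) / ((1 + t₁ ^ 2) * (1 + t₂ ^ 2)) := by
  rw [Real.sin_add, Real.sin_arctan, Real.sin_arctan, Real.cos_arctan, Real.cos_arctan]
  have h1 : 0 < √(1 + t₁ ^ 2) := Real.sqrt_pos.2 (by positivity)
  have h2 : 0 < √(1 + t₂ ^ 2) := Real.sqrt_pos.2 (by positivity)
  have e1 : √(1 + t₁ ^ 2) ^ 2 = 1 + t₁ ^ 2 := Real.sq_sqrt (by positivity)
  have e2 : √(1 + t₂ ^ 2) ^ 2 = 1 + t₂ ^ 2 := Real.sq_sqrt (by positivity)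
  generalize √(1 + t₁ ^ 2) = s₁ at *
  generalize √(1 + t₂ ^ 2) = s₂ at *
  rw [← e1, ← e2]
  field_simp

namespace Admissible

variable {ψ : ℝ → ℝ} {ξ₁ ξ₂ : ℝ}

theorem aemeasurable_poissonSum (h : Admissible ψ) (ξ₁ ξ₂ : ℝ) :
    AEMeasurable (fun ζ => ψ (ζ ^ 2)) (poissonSum ξ₁ ξ₂) :=
  (h.aemeasurable_comp_sq ξ₁).add_measure (h.aemeasurable_comp_sq ξ₂)

theorem ae_nonneg (h : Admissible ψ) (ξ₁ ξ₂ : ℝ) : ∀ᵐ ζ ∂poissonSum ξ₁ ξ₂, 0 ≤ ψ (ζ ^ 2) := by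
  filter_upwards [ae_poissonSum_pos ξ₁ ξ₂] with ζ hζ
  exact (h.pos _ (by positivity)).le

theorem integrable_log_poissonSum (h : Admissible ψ) (h₁ : 0 < ξ₁) (h₂ : 0 < ξ₂) :
    Integrable (fun ζ => Real.log (1 + ψ (ζ ^ 2))) (poissonSum ξ₁ ξ₂) :=
  (h.integrable_log_one_add h₁).add_measure (h.integrable_log_one_add h₂)

theorem mul_exp_neg_log (h : Admissible ψ) {lam : ℝ} (hlam : 0 < lam) (t : ℝ) :
    t * Real.exp (-Real.log (ψ (lam ^ 2))) = t / ψ (lam ^ 2) := by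
  rw [Real.exp_neg, Real.exp_log (h.pos _ (by positivity)), div_eq_mul_inv]

theorem one_lt_div_iff_lt (h : Admissible ψ) {lam ζ : ℝ} (hlam : 0 < lam) (hζ : 0 < ζ) :
    1 < ψ (ζ ^ 2) / ψ (lam ^ 2) ↔ lam < ζ := by
  have hl2 : 0 < lam ^ 2 := by positivity
  have hz2 : 0 < ζ ^ 2 := by positivity
  rw [one_lt_div (h.pos _ hl2), h.strictMonoOn.lt_iff_lt hl2 hz2, sq_lt_sq₀ hlam.le hζ.le]

theorem ae_mul_exp_ne_one (h : Admissible ψ) {lam : ℝ} (hlam : 0 < lam) (ξ₁ ξ₂ : ℝ) :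
    ∀ᵐ ζ ∂poissonSum ξ₁ ξ₂, ψ (ζ ^ 2) * Real.exp (-Real.log (ψ (lam ^ 2))) ≠ 1 := by
  have hl2 : 0 < lam ^ 2 := by positivity
  filter_upwards [ae_poissonSum_pos ξ₁ ξ₂, ae_poissonSum_ne ξ₁ ξ₂ lam] with ζ hζ hne
  have hz2 : 0 < ζ ^ 2 := by positivity
  rw [h.mul_exp_neg_log hlam, Ne, div_eq_one_iff_eq (h.pos _ hl2).ne',
    h.strictMonoOn.injOn.eq_iff hz2 hl2, sq_eq_sq₀ hζ.le hlam.le]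
  exact hne

theorem integrable_log_abs_poissonSum (h : Admissible ψ) {lam : ℝ} (hlam : 0 < lam)
    (h₁ : 0 < ξ₁) (h₂ : 0 < ξ₂) :
    Integrable (fun ζ => Real.log |1 - ψ (ζ ^ 2) * Real.exp (-Real.log (ψ (lam ^ 2)))|)
      (poissonSum ξ₁ ξ₂) := by
  simp only [h.mul_exp_neg_log hlam]
  exact (h.integrable_log_abs_one_sub hlam h₁).add_measure (h.integrable_log_abs_one_sub hlam h₂)

/-- The modulus of the factor at `z = -ψ(λ²)`. -/
theorem exp_neg_integral_poissonSum (h : Admissible ψ) {lam : ℝ} (hlam : 0 < lam)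
    (h₁ : 0 < ξ₁) (h₂ : 0 < ξ₂) :
    Real.exp (-∫ ζ, Real.log |1 - ψ (ζ ^ 2) * Real.exp (-Real.log (ψ (lam ^ 2)))|
      ∂poissonSum ξ₁ ξ₂) =
      dagger (psiLambda ψ lam) ξ₁ / √(1 + (ξ₁ / lam) ^ 2) *
        (dagger (psiLambda ψ lam) ξ₂ / √(1 + (ξ₂ / lam) ^ 2)) := by
  simp only [h.mul_exp_neg_log hlam]
  rw [poissonSum, integral_add_measure (h.integrable_log_abs_one_sub hlam h₁)
    (h.integrable_log_abs_one_sub hlam h₂), neg_add, Real.exp_add,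
    h.exp_neg_integral_log_abs_one_sub hlam h₁, h.exp_neg_integral_log_abs_one_sub hlam h₂]

/-- The imaginary part of the factor on the upper side of the cut at `z = -ψ(λ²)` is, up to the
Jacobian of `λ ↦ log ψ(λ²)`, the integrand of the identity. -/
theorem tendsto_im_factor (h : Admissible ψ) {lam : ℝ} (hlam : 0 < lam)
    (h₁ : 0 < ξ₁) (h₂ : 0 < ξ₂) :
    Tendsto (fun θ : ℝ => (factor (poissonSum ξ₁ ξ₂) (fun ζ => ψ (ζ ^ 2))
        ((Real.log (ψ (lam ^ 2)) : ℝ) + θ * Complex.I)).im *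
          (2 * lam * deriv ψ (lam ^ 2) / ψ (lam ^ 2))) (𝓝[<] Real.pi)
      (𝓝 (2 * piOverTwoIntegrand ψ ξ₁ ξ₂ lam)) := by
  have hprob := isProbabilityMeasure_poissonSum h₁ h₂
  have hl2 : 0 < lam ^ 2 := by positivity
  have hψ := h.pos _ hl2
  have hb := tendsto_factor_boundary (h.aemeasurable_poissonSum ξ₁ ξ₂) (h.ae_nonneg ξ₁ ξ₂)
    (h.integrable_log_poissonSum h₁ h₂) (h.ae_mul_exp_ne_one hlam ξ₁ ξ₂)
    (h.integrable_log_abs_poissonSum hlam h₁ h₂)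
  have hset : (poissonSum ξ₁ ξ₂).real
      {ζ | 1 < ψ (ζ ^ 2) * Real.exp (-Real.log (ψ (lam ^ 2)))} =
      (poissonSum ξ₁ ξ₂).real (Ioi lam) := by
    refine measureReal_congr ?_
    filter_upwards [ae_poissonSum_pos ξ₁ ξ₂] with ζ hζ
    refine propext ?_
    change 1 < ψ (ζ ^ 2) * Real.exp (-Real.log (ψ (lam ^ 2))) ↔ lam < ζ
    rw [h.mul_exp_neg_log hlam, h.one_lt_div_iff_lt hlam hζ]
  rw [hset, poissonSum_real_Ioi h₁ h₂ hlam, h.exp_neg_integral_poissonSum hlam h₁ h₂] at hb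
  have him := ((Complex.continuous_im.tendsto _).comp hb).mul_const
    (2 * lam * deriv ψ (lam ^ 2) / ψ (lam ^ 2))
  rw [Complex.im_ofReal_mul, Complex.exp_ofReal_mul_I_im] at him
  have key := sin_arctan_add_arctan_div (ξ₁ / lam) (ξ₂ / lam)
  have hval : dagger (psiLambda ψ lam) ξ₁ / √(1 + (ξ₁ / lam) ^ 2) *
      (dagger (psiLambda ψ lam) ξ₂ / √(1 + (ξ₂ / lam) ^ 2)) *
      Real.sin (Real.arctan (ξ₁ / lam) + Real.arctan (ξ₂ / lam)) *
      (2 * lam * deriv ψ (lam ^ 2) / ψ (lam ^ 2)) = 2 * piOverTwoIntegrand ψ ξ₁ ξ₂ lam := by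
    calc _ = dagger (psiLambda ψ lam) ξ₁ * dagger (psiLambda ψ lam) ξ₂ *
          (Real.sin (Real.arctan (ξ₁ / lam) + Real.arctan (ξ₂ / lam)) /
            (√(1 + (ξ₁ / lam) ^ 2) * √(1 + (ξ₂ / lam) ^ 2))) *
          (2 * lam * deriv ψ (lam ^ 2) / ψ (lam ^ 2)) := by ring
      _ = _ := by
          rw [key, piOverTwoIntegrand]
          field_simp
  rw [hval] at him
  exact him

theorem hasDerivAt_log_comp_sq (h : Admissible ψ) {lam : ℝ} (hlam : 0 < lam) :
    HasDerivAt (fun lam => Real.log (ψ (lam ^ 2)))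
      (2 * lam * deriv ψ (lam ^ 2) / ψ (lam ^ 2)) lam := by
  have hl2 : 0 < lam ^ 2 := by positivity
  have h1 : HasDerivAt (fun lam => ψ (lam ^ 2)) (deriv ψ (lam ^ 2) * (2 * lam)) lam := by
    exact (HasDerivAt.comp (h := fun l : ℝ => l ^ 2) lam (h.hasDerivAt hl2)
      (hasDerivAt_pow 2 lam)).congr_deriv (by simp)
  convert h1.log (h.pos _ hl2).ne' using 1
  ring

theorem continuousOn_jacobian (h : Admissible ψ) :
    ContinuousOn (fun lam => 2 * lam * deriv ψ (lam ^ 2) / ψ (lam ^ 2)) (Ioi 0) := by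
  have hmaps : MapsTo (fun lam : ℝ => lam ^ 2) (Ioi 0) (Ioi 0) := fun lam hlam =>
    mem_Ioi.2 (pow_pos (mem_Ioi.1 hlam) 2)
  have h1 : ContinuousOn (fun lam : ℝ => deriv ψ (lam ^ 2)) (Ioi 0) :=
    h.continuousOn_deriv.comp (by fun_prop) hmaps
  have h2 : ContinuousOn (fun lam : ℝ => ψ (lam ^ 2)) (Ioi 0) :=
    h.contDiffOn.continuousOn.comp (by fun_prop) hmaps
  exact ((by fun_prop : ContinuousOn (fun lam : ℝ => 2 * lam) (Ioi 0)).mul h1).div h2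
    fun lam hlam => (h.pos _ (hmaps hlam)).ne'

/-- The values of `g = ψ(ζ²)` for `ζ ≤ λ / 2` stay away from `ψ(λ²)`. -/
theorem ae_le_abs_one_sub (h : Admissible ψ) {lam : ℝ} (hlam : 0 < lam) (ξ₁ ξ₂ : ℝ) :
    ∀ᵐ ζ ∂poissonSum ξ₁ ξ₂, ζ ∈ Iic (lam / 2) → 1 - ψ ((lam / 2) ^ 2) / ψ (lam ^ 2) ≤
      |1 - ψ (ζ ^ 2) * Real.exp (-Real.log (ψ (lam ^ 2)))| := by
  have hψ := h.pos (lam ^ 2) (by positivity)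
  filter_upwards [ae_poissonSum_pos ξ₁ ξ₂] with ζ hζ hmem
  rw [h.mul_exp_neg_log hlam]
  have h1 : ψ (ζ ^ 2) ≤ ψ ((lam / 2) ^ 2) := h.le (by positivity) (by
    have : ζ ≤ lam / 2 := hmem
    gcongr)
  refine le_trans ?_ (le_abs_self _)
  gcongr

/-- The identity on a compact interval of `λ`: the limit `θ → π` of Cauchy's theorem, in the
variable `x = log ψ(λ²)`. -/
theorem integral_piOverTwoIntegrand (h : Admissible ψ) (h₁ : 0 < ξ₁) (h₂ : 0 < ξ₂) {α β : ℝ}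
    (hα : 0 < α) (hαβ : α ≤ β) :
    IntervalIntegrable (piOverTwoIntegrand ψ ξ₁ ξ₂) volume α β ∧
    2 * ∫ lam in α..β, piOverTwoIntegrand ψ ξ₁ ξ₂ lam =
      arcIntegral (poissonSum ξ₁ ξ₂) (fun ζ => ψ (ζ ^ 2)) (Real.log (ψ (β ^ 2))) -
        arcIntegral (poissonSum ξ₁ ξ₂) (fun ζ => ψ (ζ ^ 2)) (Real.log (ψ (α ^ 2))) := by
  have hprob := isProbabilityMeasure_poissonSum h₁ h₂
  have hg := h.aemeasurable_poissonSum ξ₁ ξ₂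
  have h0 := h.ae_nonneg ξ₁ ξ₂
  have hlog := h.integrable_log_poissonSum h₁ h₂
  have hβ : 0 < β := hα.trans_le hαβ
  have hsub : uIcc α β ⊆ Ioi 0 := by
    rw [uIcc_of_le hαβ]
    exact fun x hx => hα.trans_le hx.1
  obtain ⟨B₁, hB₁⟩ := h.exists_dagger_le hα hαβ h₁
  obtain ⟨B₂, hB₂⟩ := h.exists_dagger_le hα hαβ h₂
  set J : ℝ → ℝ := fun lam => 2 * lam * deriv ψ (lam ^ 2) / ψ (lam ^ 2) with hJ
  set F : ℝ → ℝ → ℝ := fun θ lam => (factor (poissonSum ξ₁ ξ₂) (fun ζ => ψ (ζ ^ 2))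
        ((Real.log (ψ (lam ^ 2)) : ℝ) + θ * Complex.I)).im with hF
  have hJc : ContinuousOn J (uIcc α β) := h.continuousOn_jacobian.mono hsub
  have hXc : ContinuousOn (fun lam => Real.log (ψ (lam ^ 2))) (uIcc α β) := fun x hx =>
    (h.hasDerivAt_log_comp_sq (hsub hx)).continuousAt.continuousWithinAt
  have hbound : ∀ θ : ℝ, |θ| < Real.pi → ∀ lam ∈ uIoc α β, ‖F θ lam * J lam‖ ≤
      B₁ * B₂ * J lam := by
    intro θ hθ lam hmem
    rw [uIoc_of_le hαβ] at hmem
    have hlam : 0 < lam := hα.trans hmem.1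
    have hmem' : lam ∈ Icc α β := ⟨hmem.1.le, hmem.2⟩
    have hJ0 : 0 ≤ J lam := by
      have hl2 : 0 < lam ^ 2 := by positivity
      have := h.pos _ hl2
      have := h.deriv_pos _ hl2
      positivity
    rw [norm_mul, Real.norm_of_nonneg hJ0]
    refine mul_le_mul_of_nonneg_right ?_ hJ0
    refine (Complex.abs_im_le_norm _).trans ?_
    refine (norm_factor_le_boundary hg h0 hlog (h.ae_mul_exp_ne_one hlam ξ₁ ξ₂)
      (h.integrable_log_abs_poissonSum hlam h₁ h₂) hθ).trans ?_
    rw [h.exp_neg_integral_poissonSum hlam h₁ h₂]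
    have hd : ∀ ξ, 0 ≤ dagger (psiLambda ψ lam) ξ := fun ξ => (Real.exp_pos _).le
    have hdiv : ∀ ξ, dagger (psiLambda ψ lam) ξ / √(1 + (ξ / lam) ^ 2) ≤
        dagger (psiLambda ψ lam) ξ := fun ξ =>
      div_le_self (hd ξ) (Real.one_le_sqrt.2 (by nlinarith [sq_nonneg (ξ / lam)]))
    exact mul_le_mul ((hdiv _).trans (hB₁ lam hmem')) ((hdiv _).trans (hB₂ lam hmem'))
      (div_nonneg (hd _) (Real.sqrt_nonneg _)) ((hd _).trans (hB₁ lam hmem'))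
  have hmeas : ∀ θ : ℝ, |θ| < Real.pi →
      AEStronglyMeasurable (fun lam => F θ lam * J lam) (volume.restrict (uIoc α β)) := by
    intro θ hθ
    refine ContinuousOn.aestronglyMeasurable ?_ measurableSet_uIoc
    refine ContinuousOn.mono ?_ uIoc_subset_uIcc
    exact ((Complex.continuous_im.comp (continuous_factor_line hg h0 hlog hθ)).comp_continuousOn
      hXc).mul hJc
  have hlim : ∀ lam ∈ uIoc α β, Tendsto (fun θ => F θ lam * J lam) (𝓝[<] Real.pi)
      (𝓝 (2 * piOverTwoIntegrand ψ ξ₁ ξ₂ lam)) := fun lam hmem =>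
    h.tendsto_im_factor (hsub (uIoc_subset_uIcc hmem)) h₁ h₂
  have hbi : IntervalIntegrable (fun lam => B₁ * B₂ * J lam) volume α β :=
    (hJc.const_mul _).intervalIntegrable
  have hnear : ∀ᶠ θ : ℝ in 𝓝[<] Real.pi, 0 < θ ∧ θ < Real.pi := by
    filter_upwards [nhdsWithin_le_nhds (lt_mem_nhds Real.pi_pos), self_mem_nhdsWithin]
      with θ hθ1 hθ2 using ⟨hθ1, hθ2⟩
  constructor
  -- The integrand is measurable as a limit of continuous functions along a sequence `θ → π`.
  · obtain ⟨u, -, hu, hut⟩ := exists_seq_strictMono_tendsto' Real.pi_pos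
    have hut' : Tendsto u atTop (𝓝[<] Real.pi) :=
      tendsto_nhdsWithin_iff.2 ⟨hut, Eventually.of_forall fun n => (hu n).2⟩
    have hua : ∀ n, |u n| < Real.pi := fun n => by
      rw [abs_of_pos (hu n).1]
      exact (hu n).2
    have hi : IntervalIntegrable (fun lam => 2 * piOverTwoIntegrand ψ ξ₁ ξ₂ lam) volume α β := by
      refine hbi.mono_fun' ?_ ?_
      · refine aestronglyMeasurable_of_tendsto_ae atTop (fun n => hmeas (u n) (hua n)) ?_
        filter_upwards [ae_restrict_mem measurableSet_uIoc] with lam hmem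
        exact (hlim lam hmem).comp hut'
      · filter_upwards [ae_restrict_mem measurableSet_uIoc] with lam hmem
        exact le_of_tendsto ((hlim lam hmem).comp hut').norm
          (Eventually.of_forall fun n => hbound (u n) (hua n) lam hmem)
    have := hi.const_mul (1 / 2)
    refine this.congr_ae (Eventually.of_forall fun lam => ?_)
    simp only
    ring
  · have hdct : Tendsto (fun θ => ∫ lam in α..β, F θ lam * J lam) (𝓝[<] Real.pi)
        (𝓝 (∫ lam in α..β, 2 * piOverTwoIntegrand ψ ξ₁ ξ₂ lam)) := by
      refine intervalIntegral.tendsto_integral_filter_of_dominated_convergence _ ?_ ?_ hbi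
        (Eventually.of_forall hlim)
      · filter_upwards [hnear] with θ hθ
        exact hmeas θ (by rw [abs_of_pos hθ.1]; exact hθ.2)
      · filter_upwards [hnear] with θ hθ
        exact Eventually.of_forall (hbound θ (by rw [abs_of_pos hθ.1]; exact hθ.2))
    rw [intervalIntegral.integral_const_mul] at hdct
    have hc : ∀ lam : ℝ, 0 < lam → 0 < 1 - ψ ((lam / 2) ^ 2) / ψ (lam ^ 2) := by
      intro lam hlam
      rw [sub_pos, div_lt_one (h.pos _ (by positivity))]
      exact h.lt (by positivity) (by gcongr; linarith)
    have hcauchy := (tendsto_integral_arc hg h0 hlog measurableSet_Iic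
        (poissonSum_real_Iic_pos h₁ h₂ (half_pos hβ)) (hc β hβ)
        (h.ae_le_abs_one_sub hβ ξ₁ ξ₂)).sub
      (tendsto_integral_arc hg h0 hlog measurableSet_Iic
        (poissonSum_real_Iic_pos h₁ h₂ (half_pos hα)) (hc α hα)
        (h.ae_le_abs_one_sub hα ξ₁ ξ₂))
    refine tendsto_nhds_unique hdct (hcauchy.congr' ?_)
    filter_upwards [hnear] with θ hθ
    rw [← integral_im_factor hg h0 hlog _ _ hθ.1.le hθ.2]
    have hθ' : |θ| < Real.pi := by rw [abs_of_pos hθ.1]; exact hθ.2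
    exact (intervalIntegral.integral_comp_mul_deriv'
      (g := fun x : ℝ => (factor (poissonSum ξ₁ ξ₂) (fun ζ => ψ (ζ ^ 2)) (x + θ * Complex.I)).im)
      (fun lam hlam => h.hasDerivAt_log_comp_sq (hsub hlam)) hJc
      (Complex.continuous_im.comp (continuous_factor_line hg h0 hlog hθ')).continuousOn).symm

/-- Integrability of `log (1 + ψ(ζ²)) / ζ²` at `0` forces `ψ(0+) = 0`. -/
theorem exists_lt (h : Admissible ψ) {c : ℝ} (hc : 0 < c) : ∃ x, 0 < x ∧ ψ x < c := by
  by_contra! hcon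
  have hl : 0 < Real.log (1 + c) := Real.log_pos (by linarith)
  -- Otherwise `log (1 + c) / ζ²` would be integrable at `0`.
  have hi : IntegrableOn (fun ζ : ℝ => ζ ^ (-2 : ℝ)) (Ioo 0 1) := by
    refine Integrable.mono' ((h.integrable.mono_set Ioo_subset_Ioi_self).const_mul
      (Real.log (1 + c))⁻¹) (by fun_prop) ?_
    filter_upwards [ae_restrict_mem measurableSet_Ioo] with ζ hζ
    have hζ0 : 0 < ζ := hζ.1
    rw [Real.norm_of_nonneg (Real.rpow_nonneg hζ0.le _), Real.rpow_neg hζ0.le, Real.rpow_two,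
      ← mul_div_assoc, ← one_div, div_le_div_iff_of_pos_right (by positivity), ← div_eq_inv_mul,
      one_le_div hl]
    exact Real.log_le_log (by linarith) (by linarith [hcon (ζ ^ 2) (by positivity)])
  rw [intervalIntegral.integrableOn_Ioo_rpow_iff one_pos] at hi
  norm_num at hi

theorem tendsto_log_atBot (h : Admissible ψ) :
    Tendsto (fun n : ℕ => Real.log (ψ ((1 / ((n : ℝ) + 1)) ^ 2))) atTop atBot := by
  rw [tendsto_atBot]
  intro b
  obtain ⟨x, hx, hxb⟩ := h.exists_lt (Real.exp_pos b)
  have ht : Tendsto (fun n : ℕ => (1 / ((n : ℝ) + 1)) ^ 2) atTop (𝓝 (0 ^ 2)) :=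
    tendsto_one_div_add_atTop_nhds_zero_nat.pow 2
  rw [zero_pow two_ne_zero] at ht
  filter_upwards [ht.eventually_lt_const hx] with n hn
  have hn0 : 0 < (1 / ((n : ℝ) + 1)) ^ 2 := by positivity
  rw [← Real.log_exp b]
  exact Real.log_le_log (h.pos _ hn0) ((h.lt hn0 hn).le.trans hxb.le)

theorem tendsto_arcIntegral_zero (h : Admissible ψ) (h₁ : 0 < ξ₁) (h₂ : 0 < ξ₂) :
    Tendsto (fun n : ℕ => arcIntegral (poissonSum ξ₁ ξ₂) (fun ζ => ψ (ζ ^ 2))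
      (Real.log (ψ ((1 / ((n : ℝ) + 1)) ^ 2)))) atTop (𝓝 0) := by
  have hprob := isProbabilityMeasure_poissonSum h₁ h₂
  refine (tendsto_arcIntegral_atBot (h.aemeasurable_poissonSum ξ₁ ξ₂) (h.ae_nonneg ξ₁ ξ₂)
    (h.integrable_log_poissonSum h₁ h₂) measurableSet_Ioi (poissonSum_real_Ioi_pos h₁ h₂ one_pos)
    (h.pos 1 one_pos) (Eventually.of_forall fun ζ hζ => ?_)).comp h.tendsto_log_atBot
  have : 1 < ζ := hζ
  exact h.le one_pos (by nlinarith)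

theorem tendsto_arcIntegral_pi (h : Admissible ψ) (h₁ : 0 < ξ₁) (h₂ : 0 < ξ₂) :
    Tendsto (fun n : ℕ => arcIntegral (poissonSum ξ₁ ξ₂) (fun ζ => ψ (ζ ^ 2))
      (Real.log (ψ (((n : ℝ) + 1) ^ 2)))) atTop (𝓝 Real.pi) := by
  have hprob := isProbabilityMeasure_poissonSum h₁ h₂
  have hS : ∀ᵐ ζ ∂poissonSum ξ₁ ξ₂, ζ ∈ Iic (1 : ℝ) → ψ (ζ ^ 2) ≤ ψ 1 := by
    filter_upwards [ae_poissonSum_pos ξ₁ ξ₂] with ζ hζ hmem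
    have : ζ ≤ 1 := hmem
    exact h.le (by positivity) (by nlinarith)
  have hmono : Monotone fun n : ℕ => ψ (((n : ℝ) + 1) ^ 2) := fun m n hmn =>
    h.le (by positivity) (by gcongr)
  -- Either the cut is the whole half-line, or it ends at `-M` with `M = sup ψ`.
  rcases tendsto_atTop_of_monotone hmono with hinf | ⟨M, hM⟩
  · exact (tendsto_arcIntegral_atTop (h.aemeasurable_poissonSum ξ₁ ξ₂) (h.ae_nonneg ξ₁ ξ₂)
      (h.integrable_log_poissonSum h₁ h₂) measurableSet_Iic
      (poissonSum_real_Iic_pos h₁ h₂ one_pos) hS).comp (Real.tendsto_log_atTop.comp hinf)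
  · have hle : ∀ n : ℕ, ψ (((n : ℝ) + 1) ^ 2) ≤ M := fun n => hmono.ge_of_tendsto hM n
    have h1M : ψ 1 < M := by
      refine lt_of_lt_of_le (h.lt one_pos ?_) (hle 1)
      norm_num
    have hM0 : 0 < M := (h.pos 1 one_pos).trans h1M
    have hgM : ∀ᵐ ζ ∂poissonSum ξ₁ ξ₂, ψ (ζ ^ 2) ≤ M := by
      filter_upwards [ae_poissonSum_pos ξ₁ ξ₂] with ζ hζ
      obtain ⟨n, hn⟩ := exists_nat_ge ζ
      refine (h.le (by positivity) ?_).trans (hle n)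
      have : ζ ≤ n + 1 := by linarith
      gcongr
    exact (tendsto_arcIntegral_of_bounded (h.aemeasurable_poissonSum ξ₁ ξ₂) (h.ae_nonneg ξ₁ ξ₂)
      (h.integrable_log_poissonSum h₁ h₂) hM0 hgM measurableSet_Iic
      (poissonSum_real_Iic_pos h₁ h₂ one_pos) h1M hS).comp
        ((Real.continuousAt_log hM0.ne').tendsto.comp hM)

theorem piOverTwoIntegrand_nonneg (h : Admissible ψ) (h₁ : 0 < ξ₁) (h₂ : 0 < ξ₂) {lam : ℝ}
    (hlam : 0 < lam) : 0 ≤ piOverTwoIntegrand ψ ξ₁ ξ₂ lam := by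
  have hl2 : 0 < lam ^ 2 := by positivity
  have := h.pos _ hl2
  have := h.deriv_pos _ hl2
  have hd : ∀ ξ, 0 < dagger (psiLambda ψ lam) ξ := fun ξ => Real.exp_pos _
  have := hd ξ₁
  have := hd ξ₂
  unfold piOverTwoIntegrand
  positivity

theorem integrableOn_and_integral_eq (h : Admissible ψ) (h₁ : 0 < ξ₁) (h₂ : 0 < ξ₂) :
    IntegrableOn (piOverTwoIntegrand ψ ξ₁ ξ₂) (Ioi 0) ∧
      ∫ lam in Ioi 0, piOverTwoIntegrand ψ ξ₁ ξ₂ lam = Real.pi / 2 := by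
  have ha : ∀ n : ℕ, 0 < 1 / ((n : ℝ) + 1) := fun n => by positivity
  have hab : ∀ n : ℕ, 1 / ((n : ℝ) + 1) ≤ (n : ℝ) + 1 := fun n => by
    have h1 : (1 : ℝ) ≤ (n : ℝ) + 1 := by linarith [n.cast_nonneg (α := ℝ)]
    exact ((div_le_one (by positivity)).2 h1).trans h1
  have hcover : AECover (volume.restrict (Ioi (0 : ℝ))) atTop
      fun n : ℕ => Ioc (1 / ((n : ℝ) + 1)) ((n : ℝ) + 1) :=
    (aecover_Ioi_of_Ioi tendsto_one_div_add_atTop_nhds_zero_nat).inter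
      (aecover_Iic (tendsto_atTop_add_const_right _ _ tendsto_natCast_atTop_atTop)).restrict
  have hrestr : ∀ n : ℕ, (volume.restrict (Ioi (0 : ℝ))).restrict
      (Ioc (1 / ((n : ℝ) + 1)) ((n : ℝ) + 1)) =
      volume.restrict (Ioc (1 / ((n : ℝ) + 1)) ((n : ℝ) + 1)) := fun n =>
    Measure.restrict_restrict_of_subset fun x hx => (ha n).trans hx.1
  have hint : ∀ n : ℕ, IntegrableOn (piOverTwoIntegrand ψ ξ₁ ξ₂)
      (Ioc (1 / ((n : ℝ) + 1)) ((n : ℝ) + 1)) (volume.restrict (Ioi 0)) := by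
    intro n
    rw [IntegrableOn, hrestr]
    exact (h.integral_piOverTwoIntegrand h₁ h₂ (ha n) (hab n)).1.1
  have hlim : Tendsto (fun n : ℕ => ∫ lam in Ioc (1 / ((n : ℝ) + 1)) ((n : ℝ) + 1),
      piOverTwoIntegrand ψ ξ₁ ξ₂ lam ∂(volume.restrict (Ioi 0))) atTop (𝓝 (Real.pi / 2)) := by
    have := ((h.tendsto_arcIntegral_pi h₁ h₂).sub (h.tendsto_arcIntegral_zero h₁ h₂)).div_const 2
    rw [sub_zero] at this
    refine this.congr fun n => ?_
    rw [hrestr, ← intervalIntegral.integral_of_le (hab n),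
      ← (h.integral_piOverTwoIntegrand h₁ h₂ (ha n) (hab n)).2]
    ring
  have hnn : ∀ᵐ lam ∂(volume.restrict (Ioi (0 : ℝ))), 0 ≤ piOverTwoIntegrand ψ ξ₁ ξ₂ lam := by
    filter_upwards [ae_restrict_mem measurableSet_Ioi] with lam hlam
    exact h.piOverTwoIntegrand_nonneg h₁ h₂ hlam
  exact ⟨hcover.integrable_of_integral_tendsto_of_nonneg_ae _ hint hnn hlim,
    hcover.integral_eq_of_tendsto_of_nonneg_ae _ hnn hint hlim⟩

end Admissible

end WienerHopf

theorem mainTheorem5 (ψ : ℝ → ℝ)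
    (hpos : ∀ x : ℝ, 0 < x → 0 < ψ x)
    (hC1 : ContDiffOn ℝ 1 ψ (Ioi (0 : ℝ)))
    (hderiv : ∀ x : ℝ, 0 < x → 0 < deriv ψ x)
    (hint : IntegrableOn (fun ζ : ℝ => Real.log (1 + ψ (ζ ^ 2)) / ζ ^ 2) (Ioi (0 : ℝ)) volume) :
    (∀ lam : ℝ, 0 < lam → ∀ ξ : ℝ, 0 < ξ →
      (∀ ζ : ℝ, 0 < ζ → 0 < psiLambda ψ lam (ζ ^ 2)) ∧
      IntegrableOn (fun ζ : ℝ => daggerIntegrand (psiLambda ψ lam) ξ ζ) (Ioi (0 : ℝ)) volume) ∧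
    ∀ ξ₁ ξ₂ : ℝ, 0 < ξ₁ → 0 < ξ₂ →
      IntegrableOn (fun lam : ℝ => piOverTwoIntegrand ψ ξ₁ ξ₂ lam) (Ioi (0 : ℝ)) volume ∧
      ∫ lam in Ioi (0 : ℝ), piOverTwoIntegrand ψ ξ₁ ξ₂ lam = Real.pi / 2 := by
  have h : WienerHopf.Admissible ψ := ⟨hpos, hC1, hderiv, hint⟩
  exact ⟨fun lam hlam ξ hξ => ⟨fun ζ hζ => h.psiLambda_pos hlam (by positivity),
    h.integrableOn_daggerIntegrand hlam hξ⟩,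
    fun ξ₁ ξ₂ h₁ h₂ => h.integrableOn_and_integral_eq h₁ h₂⟩
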